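/- **Theorem.** Let $N,K,t,r,M\ge 0$ be integers with $J:=t+r\le N$ and $K-M\ge N$. Put $E_t=[I_t\ \ 0_{t\times(N-t)}]^T$, $E_r=[0_{r\times t}\ \ I_r\ \ 0_{r\times(N-J)}]^T$, $A=[E_t\ \ E_r]\in\mathbb C^{N\times J}$, $C=[I_M\ \ 0_{M\times(K-M)}]$, and consider the (canonical I-GMANOVA) problem of testing, from a data matrix $Z\in\mathbb C^{N\times K}$, $$\mathcal H_0:\ Z=E_tB_{t,0}C+\mathcal N\qquad\text{against}\qquad \mathcal H_1:\ Z=AB_sC+\mathcal N,\quad B_s=\begin{bmatrix}B_{t,1}\\ B\end{bmatrix},$$ where $B_{t,i}\in\mathbb C^{t\times M}$ and $B\in\mathbb C^{r\times M}$ are unknown and $\mathcal N$ has independent columns distributed as $\mathcal{CN}_N(0,R)$ with unknown positive definite $R$. Thus under $\mathcal H_1$ the density is $$f_1(Z;B_s,R)=\pi^{-NK}\det(R)^{-K}\exp\left(-\mathrm{Tr}[R^{-1}(Z-AB_sC)(Z-AB_sC)^\dagger]\right),$$ and $f_0(Z;B_{t,0},R)$ is obtained by replacing $AB_sC$ with $E_tB_{t,0}C$.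 Let $\theta_r\in\mathbb R^{2rM}$ collect the real and imaginary parts of $\mathrm{vec}(B)$, let $\theta_s\in\mathbb R^{2tM+N^2}$ collect those of $\mathrm{vec}(B_t)$ and the $N^2$ real parameters of $R$, and put $\theta=(\theta_r,\theta_s)$. Let $I(\theta)=\mathbb E_\theta\left[\frac{\partial\ln f_1}{\partial\theta}\frac{\partial\ln f_1}{\partial\theta^T}\right]$ be the Fisher information matrix, where $\mathbb E_\theta$ is the expectation for $Z$ with density $f_1(\cdot;\theta)$. Let $\hat\theta_{s,0}$ be the maximum likelihood estimate of $\theta_s$ under $\mathcal H_0$, $\theta_{r,0}=0$, $\hat\theta_0=(\theta_{r,0},\hat\theta_{s,0})$ and $\hat\theta_{r,01}=\arg\max_{\theta_r}f_1(Z;\theta_r,\hat\theta_{s,0})$. The Durbin statistic is $$t_{\rm d}(Z)=(\hat\theta_{r,01}-\theta_{r,0})^T\,[I(\hat\theta_0)]_{\theta_r,\theta_r}[I^{-1}(\hat\theta_0)]_{\theta_r,\theta_r}[I(\hat\theta_0)]_{\theta_r,\theta_r}\,(\hat\theta_{r,01}-\theta_{r,0}),$$ and the Rao statistic is $$t_{\rm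 r}(Z)=\frac{\partial\ln f_1(Z;\theta)}{\partial\theta_r^T}\Big|_{\hat\theta_0}[I^{-1}(\hat\theta_0)]_{\theta_r,\theta_r}\frac{\partial\ln f_1(Z;\theta)}{\partial\theta_r}\Big|_{\hat\theta_0}.$$ For a matrix $X$ of full column rank let $P_X=X(X^\dagger X)^{-1}X^\dagger$. Put $S_c=Z(I-P_{C^\dagger})Z^\dagger$ and, when $S_c$ is positive definite, $A_0=S_c^{-1/2}E_t$, $Q=S_c^{1/2}P_{A_0}S_c^{-1/2}$, $Z_{d,0}=Z-QZP_{C^\dagger}$ and $$\hat R_0=K^{-1}\left[S_c+(Z-QZ)P_{C^\dagger}(Z-QZ)^\dagger\right],$$ and let $\hat\Gamma^\circ_{22}$ be the lower right $r\times r$ block of $\hat\Gamma^\circ=(A^\dagger\hat R_0^{-1}A)^{-1}$. Then: 1. For every $\theta$ whose covariance part is positive definite, $f_1(\cdot;\theta)$ is a probability density, $\ln f_1(Z;\cdot)$ is differentiable at $\theta$ for every $Z$, the expectations defining $I(\theta)$ are finite, and $I(\theta)$ is nonsingular. For Lebesgue-almost every $Z$ the matrix $S_c$ is positive definite. 2.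 For every $Z$ for which $S_c$ is positive definite, $\hat\theta_{s,0}$ and $\hat\theta_{r,01}$ exist and are unique, the covariance part of $\hat\theta_{s,0}$ is $\hat R_0$, and $$t_{\rm d}(Z)=t_{\rm r}(Z)=2\,\mathrm{Tr}\left[Z_{d,0}^\dagger\hat R_0^{-1}E_r\,\hat\Gamma^\circ_{22}\,E_r^\dagger\hat R_0^{-1}Z_{d,0}P_{C^\dagger}\right].$$ 3. Consequently the Durbin statistic is statistically equivalent to the Rao statistic, in its generic form and in its closed (trace) form: outside a Lebesgue-null set of data, $t_{\rm d}$ is a strictly increasing function of the other statistic. 4. The Durbin test is CFAR: $t_{\rm d}$ is measurable up to a null set and, for every threshold $\eta$, the false alarm probability $\mathbb P(t_{\rm d}(Z)>\eta)$ under $\mathcal H_0$ is the same for all $B_{t,0}\in\mathbb C^{t\times M}$ and all positive definite $R$. -/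

import Mathlib

open MeasureTheory Matrix
open scoped MatrixOrder ComplexOrder

noncomputable section

namespace IGmanova

/-! ### The canonical model

Data are matrices `Z` with `N` rows and `K` columns. The interference spans the first `t`
coordinates, the useful signal the next `r` coordinates, and both occupy the first `M` columns. -/

/-- `E_t = [I_t  0]ᵀ`, the left subspace of the interference. -/
def Et (N t : ℕ) : Matrix (Fin N) (Fin t) ℂ :=
  Matrix.of fun i j => if (i : ℕ) = (j : ℕ) then 1 else 0

/-- `E_r = [0  I_r  0]ᵀ`, the left subspace of the useful signal. -/
def Er (N t r : ℕ) : Matrix (Fin N) (Fin r) ℂ :=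
  Matrix.of fun i j => if (i : ℕ) = t + (j : ℕ) then 1 else 0

/-- `A = [E_t  E_r]`. -/
def leftA (N t r : ℕ) : Matrix (Fin N) (Fin t ⊕ Fin r) ℂ :=
  Matrix.fromCols (Et N t) (Er N t r)

/-- `C = [I_M  0]`. -/
def rightC (M K : ℕ) : Matrix (Fin M) (Fin K) ℂ :=
  Matrix.of fun i j => if (i : ℕ) = (j : ℕ) then 1 else 0

/-- Density of a complex proper Gaussian matrix with mean `μ` and independent columns of
covariance `R`:
`π^{-NK} det(R)^{-K} exp(-Tr[R⁻¹ (Z - μ)(Z - μ)†])`. -/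
def gaussDensity {N K : ℕ} (Z μ : Matrix (Fin N) (Fin K) ℂ) (R : Matrix (Fin N) (Fin N) ℂ) : ℝ :=
  (Real.pi ^ (N * K))⁻¹ * (R.det.re ^ K)⁻¹ *
    Real.exp (-(Matrix.trace (R⁻¹ * (Z - μ) * (Z - μ)ᴴ)).re)

/-- The density under the alternative, with `B_s` the stacked matrix of interference and signal. -/
def f1 {N K t r M : ℕ} (Z : Matrix (Fin N) (Fin K) ℂ) (Bs : Matrix (Fin t ⊕ Fin r) (Fin M) ℂ)
    (R : Matrix (Fin N) (Fin N) ℂ) : ℝ :=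
  gaussDensity Z (leftA N t r * Bs * rightC M K) R

/-- The density under the null hypothesis. -/
def f0 {N K t M : ℕ} (Z : Matrix (Fin N) (Fin K) ℂ) (Bt : Matrix (Fin t) (Fin M) ℂ)
    (R : Matrix (Fin N) (Fin N) ℂ) : ℝ :=
  gaussDensity Z (Et N t * Bt * rightC M K) R

/-- The law of the data under the alternative. -/
def law1 (K : ℕ) {N t r M : ℕ} (Bs : Matrix (Fin t ⊕ Fin r) (Fin M) ℂ)
    (R : Matrix (Fin N) (Fin N) ℂ) : Measure (Fin N → Fin K → ℂ) :=
  volume.withDensity fun Z => ENNReal.ofReal (f1 (Matrix.of Z) Bs R)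

/-- The law of the data under the null hypothesis. -/
def law0 (K : ℕ) {N t M : ℕ} (Bt : Matrix (Fin t) (Fin M) ℂ)
    (R : Matrix (Fin N) (Fin N) ℂ) : Measure (Fin N → Fin K → ℂ) :=
  volume.withDensity fun Z => ENNReal.ofReal (f0 (Matrix.of Z) Bt R)

/-! ### The real parameter vector -/

/-- Positions of the real vector made of the real part (left) and the imaginary part (right)
of `vec B`, for a matrix `B` with `p` rows and `M` columns. -/
abbrev VecIdx (p M : ℕ) : Type := (Fin M × Fin p) ⊕ (Fin M × Fin p)

/-- Positions of the nuisance vector: interference matrix, then the `N²` real entries of `R`. -/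
abbrev NuisIdx (t M N : ℕ) : Type := VecIdx t M ⊕ (Fin N × Fin N)

/-- The complex matrix whose vectorization has the given real and imaginary parts. -/
def matOf {p M : ℕ} (x : VecIdx p M → ℝ) : Matrix (Fin p) (Fin M) ℂ :=
  Matrix.of fun i m => ⟨x (Sum.inl (m, i)), x (Sum.inr (m, i))⟩

/-- The Hermitian matrix with the given diagonal, real parts above the diagonal (positions
`(i, j)`, `i < j`) and imaginary parts above the diagonal (stored at positions `(j, i)`). -/
def covOf {N : ℕ} (x : Fin N × Fin N → ℝ) : Matrix (Fin N) (Fin N) ℂ :=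
  Matrix.of fun i j =>
    if i = j then ⟨x (i, i), 0⟩
    else if i < j then ⟨x (i, j), x (j, i)⟩
    else ⟨x (j, i), -x (i, j)⟩

/-- The interference matrix `B_t` contained in the nuisance vector. -/
def nuisB {t M N : ℕ} (θs : NuisIdx t M N → ℝ) : Matrix (Fin t) (Fin M) ℂ :=
  matOf fun k => θs (Sum.inl k)

/-- The covariance matrix `R` contained in the nuisance vector. -/
def nuisR {t M N : ℕ} (θs : NuisIdx t M N → ℝ) : Matrix (Fin N) (Fin N) ℂ :=
  covOf fun k => θs (Sum.inr k)

/-- The matrix `B_s` described by the overall parameter vector. -/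
def thetaBs {t r M N : ℕ} (θ : VecIdx r M ⊕ NuisIdx t M N → ℝ) :
    Matrix (Fin t ⊕ Fin r) (Fin M) ℂ :=
  Matrix.fromRows (nuisB fun k => θ (Sum.inr k)) (matOf fun k => θ (Sum.inl k))

/-- The covariance matrix described by the overall parameter vector. -/
def thetaR {t r M N : ℕ} (θ : VecIdx r M ⊕ NuisIdx t M N → ℝ) : Matrix (Fin N) (Fin N) ℂ :=
  nuisR fun k => θ (Sum.inr k)

/-- `ln f₁(Z; θ)`. -/
def logLik {N K t r M : ℕ} (Z : Matrix (Fin N) (Fin K) ℂ)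
    (θ : VecIdx r M ⊕ NuisIdx t M N → ℝ) : ℝ :=
  Real.log (f1 Z (thetaBs θ) (thetaR θ))

/-- The score: the gradient of `ln f₁(Z; θ)` in all the real parameters. -/
def score {N K t r M : ℕ} (Z : Matrix (Fin N) (Fin K) ℂ)
    (θ : VecIdx r M ⊕ NuisIdx t M N → ℝ) : VecIdx r M ⊕ NuisIdx t M N → ℝ :=
  fun k => lineDeriv ℝ (logLik Z) θ (Pi.single k 1)

/-- The Fisher information matrix of the overall parameter vector, for `K` columns. -/
def fisher (K : ℕ) {N t r M : ℕ} (θ : VecIdx r M ⊕ NuisIdx t M N → ℝ) :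
    Matrix (VecIdx r M ⊕ NuisIdx t M N) (VecIdx r M ⊕ NuisIdx t M N) ℝ :=
  Matrix.of fun k l =>
    ∫ Z, score (Matrix.of Z) θ k * score (Matrix.of Z) θ l ∂(law1 K (thetaBs θ) (thetaR θ))

/-! ### Estimates and generic statistics -/

/-- `θs` is a maximum likelihood estimate of the nuisance vector under the null hypothesis; the
covariance ranges over the positive definite matrices. -/
def IsNullMLE {N K t M : ℕ} (Z : Matrix (Fin N) (Fin K) ℂ) (θs : NuisIdx t M N → ℝ) : Prop :=
  (nuisR θs).PosDef ∧
    ∀ θs' : NuisIdx t M N → ℝ, (nuisR θs').PosDef →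
      f0 Z (nuisB θs') (nuisR θs') ≤ f0 Z (nuisB θs) (nuisR θs)

/-- `θ̂_{s,0}`: the maximum likelihood estimate under the null hypothesis (a fixed but arbitrary
vector when there is none). -/
def thetaS0 (t M : ℕ) {N K : ℕ} (Z : Matrix (Fin N) (Fin K) ℂ) : NuisIdx t M N → ℝ :=
  Classical.epsilon (IsNullMLE Z)

/-- `θ̂_0 = [θ_{r,0}; θ̂_{s,0}]`, with `θ_{r,0} = 0`. -/
def theta0 (t r M : ℕ) {N K : ℕ} (Z : Matrix (Fin N) (Fin K) ℂ) :
    VecIdx r M ⊕ NuisIdx t M N → ℝ :=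
  Sum.elim 0 (thetaS0 t M Z)

/-- `θr` maximizes `f₁(Z; θ_r, θs)` over all `θ_r`. -/
def IsRestrictedMLE {N K t r M : ℕ} (Z : Matrix (Fin N) (Fin K) ℂ) (θs : NuisIdx t M N → ℝ)
    (θr : VecIdx r M → ℝ) : Prop :=
  ∀ θr' : VecIdx r M → ℝ,
    f1 Z (thetaBs (Sum.elim θr' θs)) (thetaR (r := r) (Sum.elim θr' θs)) ≤
      f1 Z (thetaBs (Sum.elim θr θs)) (thetaR (r := r) (Sum.elim θr θs))

/-- `θ̂_{r,01} = argmax_{θ_r} f₁(Z; θ_r, θ̂_{s,0})`. -/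
def thetaR01 (t r M : ℕ) {N K : ℕ} (Z : Matrix (Fin N) (Fin K) ℂ) : VecIdx r M → ℝ :=
  Classical.epsilon (IsRestrictedMLE Z (thetaS0 t M Z))

/-- `[I(θ)]_{θ_r,θ_r}`. -/
def fisherRR (K : ℕ) {N t r M : ℕ} (θ : VecIdx r M ⊕ NuisIdx t M N → ℝ) :
    Matrix (VecIdx r M) (VecIdx r M) ℝ :=
  (fisher K θ).toBlocks₁₁

/-- `[I⁻¹(θ)]_{θ_r,θ_r}`: the block of the inverse of the whole information matrix. -/
def fisherInvRR (K : ℕ) {N t r M : ℕ} (θ : VecIdx r M ⊕ NuisIdx t M N → ℝ) :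
    Matrix (VecIdx r M) (VecIdx r M) ℝ :=
  ((fisher K θ)⁻¹).toBlocks₁₁

/-- The Durbin (naive) statistic. -/
def durbin (t r M : ℕ) {N K : ℕ} (Z : Matrix (Fin N) (Fin K) ℂ) : ℝ :=
  let θ := theta0 t r M Z
  let δ : VecIdx r M → ℝ := thetaR01 t r M Z - 0
  δ ⬝ᵥ ((fisherRR K θ * fisherInvRR K θ * fisherRR K θ) *ᵥ δ)

/-- The Rao statistic in its generic form. -/
def rao (t r M : ℕ) {N K : ℕ} (Z : Matrix (Fin N) (Fin K) ℂ) : ℝ :=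
  let θ := theta0 t r M Z
  let g : VecIdx r M → ℝ := fun k => score Z θ (Sum.inl k)
  g ⬝ᵥ (fisherInvRR K θ *ᵥ g)

/-! ### The closed form of the Rao statistic -/

/-- The orthogonal projection `X (X†X)⁻¹ X†` of a full-column-rank matrix. -/
def proj {m n : Type*} [Fintype m] [Fintype n] [DecidableEq n] (X : Matrix m n ℂ) :
    Matrix m m ℂ :=
  X * (Xᴴ * X)⁻¹ * Xᴴ

/-- `S_c = Z P⊥ Z†`, with `P` the projection of `C†`. -/
def Sc (M : ℕ) {N K : ℕ} (Z : Matrix (Fin N) (Fin K) ℂ) : Matrix (Fin N) (Fin N) ℂ :=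
  Z * (1 - proj (rightC M K)ᴴ) * Zᴴ

/-- `S_c^{1/2} P_{A₀} S_c^{-1/2}` with `A₀ = S_c^{-1/2} E_t`. -/
def obliqueProj (t M : ℕ) {N K : ℕ} (Z : Matrix (Fin N) (Fin K) ℂ) :
    Matrix (Fin N) (Fin N) ℂ :=
  CFC.sqrt (Sc M Z) * proj ((CFC.sqrt (Sc M Z))⁻¹ * Et N t) * (CFC.sqrt (Sc M Z))⁻¹

/-- `R̂₀` in closed form. -/
def R0hat (t M : ℕ) {N K : ℕ} (Z : Matrix (Fin N) (Fin K) ℂ) : Matrix (Fin N) (Fin N) ℂ :=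
  (K : ℂ)⁻¹ • (Sc M Z + (Z - obliqueProj t M Z * Z) * proj (rightC M K)ᴴ *
    (Z - obliqueProj t M Z * Z)ᴴ)

/-- `Z_{d,0} = Z - S_c^{1/2} P_{A₀} S_c^{-1/2} Z P_{C†}`. -/
def Zd0 (t M : ℕ) {N K : ℕ} (Z : Matrix (Fin N) (Fin K) ℂ) : Matrix (Fin N) (Fin K) ℂ :=
  Z - obliqueProj t M Z * Z * proj (rightC M K)ᴴ

/-- `Γ̂° = (A† R̂₀⁻¹ A)⁻¹`. -/
def gammaHat (t r M : ℕ) {N K : ℕ} (Z : Matrix (Fin N) (Fin K) ℂ) :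
    Matrix (Fin t ⊕ Fin r) (Fin t ⊕ Fin r) ℂ :=
  ((leftA N t r)ᴴ * (R0hat t M Z)⁻¹ * leftA N t r)⁻¹

/-- `Tr[Z_{d,0}† R̂₀⁻¹ E_r Γ̂°₂₂ E_r† R̂₀⁻¹ Z_{d,0} P_{C†}]`. -/
def raoTrace (t r M : ℕ) {N K : ℕ} (Z : Matrix (Fin N) (Fin K) ℂ) : ℂ :=
  Matrix.trace ((Zd0 t M Z)ᴴ * (R0hat t M Z)⁻¹ * Er N t r * (gammaHat t r M Z).toBlocks₂₂ *
    (Er N t r)ᴴ * (R0hat t M Z)⁻¹ * Zd0 t M Z * proj (rightC M K)ᴴ)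

/-! ### Equivalence of statistics and the CFAR property -/

/-- Two statistics are statistically equivalent if, up to a null set of data, one is a strictly
increasing function of the other, so that they give the same tests. -/
def StatEquivalent {N K : ℕ} (S T : Matrix (Fin N) (Fin K) ℂ → ℝ) : Prop :=
  ∃ φ : ℝ → ℝ, StrictMono φ ∧
    ∀ᵐ Z : Fin N → Fin K → ℂ, S (Matrix.of Z) = φ (T (Matrix.of Z))

/-- The test which rejects when `S(Z) > η` has, for every threshold `η`, the same probability of
false alarm whatever the interference `B_{t,0}` and the positive definite covariance `R`. -/
def IsCFAR (t M : ℕ) {N K : ℕ} (S : Matrix (Fin N) (Fin K) ℂ → ℝ) : Prop :=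
  AEMeasurable (fun Z : Fin N → Fin K → ℂ => S (Matrix.of Z)) ∧
    ∀ (η : ℝ) (Bt Bt' : Matrix (Fin t) (Fin M) ℂ) (R R' : Matrix (Fin N) (Fin N) ℂ),
      R.PosDef → R'.PosDef →
        law0 K Bt R {Z | η < S (Matrix.of Z)} = law0 K Bt' R' {Z | η < S (Matrix.of Z)}

end IGmanova

end

open IGmanova

/-! The mean is supported on the signal columns. With `Y = Z C†`, the scatter matrix about a mean `D
C` is therefore `S_c + (Y - D)(Y - D)†`, and the data enter the likelihood only through `S_c` and
`Y`.

Null estimate. For a fixed mean, the best covariance is the scatter matrix over `K`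
(`likelihood_lt_of_ne`), because `x e^{-x}` peaks only at `x = 1`. It remains to minimize `det(S_c +
(Y - E_t B)(Y - E_t B)†)`. The identity `det(S + X X†) = det S · det(1 + X† S⁻¹ X)` and Pythagoras
for generalized least squares give the unique minimizer (`det_scatter_lt`, `f0_lt`). Its residual
`X` satisfies `E_t† R̂₀⁻¹ X = 0`.

Durbin equals Rao. With the covariance frozen, the log-likelihood is exactly quadratic in the
signal. Its Hessian is minus the information block, so maximizing gives `I_rr θ̂_{r,01} = g`, with
`g` the signal score at the null estimate (`fisherRR_mulVec_thetaR01`). Substituting this into the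
Durbin form gives the Rao form. The information is computed from Stein's identity, which also makes
mean and covariance directions orthogonal. It is nonsingular because a direction in its kernel has a
score vanishing identically in the data.

Closed form. Let `v` carry the least squares fit of `X` by all of `A = [E_t E_r]`. The normal
equations and `E_t† R̂₀⁻¹ X = 0` give `I v = (g, 0)`. No block of `I⁻¹` has to be computed:
`[I⁻¹]_rr g` is the signal part of `v`, and the Rao statistic is the score along `v`
(`fisher_mulVec_raoDir`, `rao_eq`).

CFAR. An upper triangular factor `T` of `R = T T†` preserves the ranges of `E_t` and `A`. Null data
are `T Z₀ + E_t B C` with `Z₀` standard, and equivariance of least squares removes `T` and `B` from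
the statistic (`closedStat_affine`). -/

namespace IGmanova

/-! ### Extremal inequalities for determinants and traces of positive definite matrices -/

section MatrixFacts

variable {n : Type*} [Fintype n] [DecidableEq n]

theorem exists_isUnit_conjTranspose_mul_self {R : Matrix n n ℂ} (hR : R.PosDef) :
    ∃ L : Matrix n n ℂ, IsUnit L ∧ R = Lᴴ * L := by
  obtain ⟨L, hL⟩ := CStarAlgebra.nonneg_iff_eq_star_mul_self.mp hR.posSemidef.nonneg
  refine ⟨L, ?_, hL⟩
  have h := hR.isUnit
  rw [hL, Matrix.isUnit_iff_isUnit_det, det_mul] at h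
  exact (Matrix.isUnit_iff_isUnit_det _).2 (isUnit_of_mul_isUnit_right h)

theorem eq_one_of_eigenvalues_eq_one {V : Matrix n n ℂ} (hV : V.IsHermitian)
    (h : ∀ i, hV.eigenvalues i = 1) : V = 1 := by
  have h1 := hV.spectral_theorem
  have h2 : (RCLike.ofReal ∘ hV.eigenvalues : n → ℂ) = 1 := by
    ext i; simp [h i]
  rw [h2] at h1
  rw [h1]
  simp

theorem det_re_eq_prod {V : Matrix n n ℂ} (hV : V.IsHermitian) :
    V.det.re = ∏ i, hV.eigenvalues i := by
  rw [hV.det_eq_prod_eigenvalues]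
  norm_cast

theorem trace_re_eq_sum {V : Matrix n n ℂ} (hV : V.IsHermitian) :
    V.trace.re = ∑ i, hV.eigenvalues i := by
  rw [hV.trace_eq_sum_eigenvalues]
  norm_cast

/-- Determinant and trace split over the eigenvalues, and each factor `x e^{-x}` is at most `e^{-1}`
with equality only at `x = 1`. If every factor attained the bound, `V` would be the identity. -/
theorem det_mul_exp_neg_trace_lt {V : Matrix n n ℂ} (hV : V.PosDef) (hne : V ≠ 1) :
    V.det.re * Real.exp (-V.trace.re) < Real.exp (-Fintype.card n) := by
  have hH := hV.isHermitian
  rw [det_re_eq_prod hH, trace_re_eq_sum hH, ← Finset.sum_neg_distrib, Real.exp_sum,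
    ← Finset.prod_mul_distrib]
  have : Real.exp (-(Fintype.card n : ℝ)) = ∏ i : n, Real.exp (-1) := by
    rw [Finset.prod_const, ← Real.exp_nat_mul]
    simp
  rw [this]
  have hle (x : ℝ) (_ : 0 < x) : x * Real.exp (-x) ≤ Real.exp (-1) := by
    have h := Real.add_one_le_exp (x - 1)
    calc x * Real.exp (-x) ≤ Real.exp (x - 1) * Real.exp (-x) := by gcongr; linarith
      _ = Real.exp (-1) := by rw [← Real.exp_add]; ring_nf
  have hlt (x : ℝ) (_ : 0 < x) (h1 : x ≠ 1) : x * Real.exp (-x) < Real.exp (-1) := by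
    have h := Real.add_one_lt_exp (sub_ne_zero.2 h1)
    calc x * Real.exp (-x) < Real.exp (x - 1) * Real.exp (-x) := by gcongr; linarith
      _ = Real.exp (-1) := by rw [← Real.exp_add]; ring_nf
  refine Finset.prod_lt_prod (fun i _ => ?_) (fun i _ => hle _ (hV.eigenvalues_pos i)) ?_
  · exact mul_pos (hV.eigenvalues_pos i) (Real.exp_pos _)
  · by_contra! hcon
    refine hne (eq_one_of_eigenvalues_eq_one hH fun i => ?_)
    by_contra h1
    exact absurd (hcon i (Finset.mem_univ _)) (not_le.2 (hlt _ (hV.eigenvalues_pos i) h1))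

/-- Rayleigh quotients at unit eigenvectors show that every eigenvalue of `1 + V` is at least 1, and
they are not all 1 unless `V = 0`. -/
theorem det_one_add_ge {V : Matrix n n ℂ} (hV : V.PosSemidef) (hne : V ≠ 0) :
    1 < (1 + V).det.re := by
  have hp : (1 + V).PosDef := PosDef.one.add_posSemidef hV
  have hH := hp.isHermitian
  have hge (i : n) : 1 ≤ hH.eigenvalues i := by
    have h := hH.eigenvalues_eq i
    set x : n → ℂ := ⇑(hH.eigenvectorBasis i) with hx
    rw [Matrix.add_mulVec, dotProduct_add, one_mulVec] at h
    have h0 : star x ⬝ᵥ x = 1 := by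
      have := hH.eigenvectorBasis.orthonormal.1 i
      rw [dotProduct_comm, ← EuclideanSpace.inner_eq_star_dotProduct,
        inner_self_eq_norm_sq_to_K, this]
      simp
    have h1 := hV.re_dotProduct_nonneg x
    rw [h0, map_add] at h
    rw [RCLike.one_re] at h
    linarith
  rw [det_re_eq_prod hH]
  have : (1 : ℝ) = ∏ _i : n, (1 : ℝ) := by simp
  rw [this]
  refine Finset.prod_lt_prod (fun i _ => one_pos) (fun i _ => hge i) ?_
  by_contra! hcon
  apply hne
  have := eq_one_of_eigenvalues_eq_one hH fun i =>
    le_antisymm (hcon i (Finset.mem_univ _)) (hge i)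
  simpa using this

/-- Writing `P = L† L`, a congruence by `L⁻¹` reduces the claim to `P = 1`. -/
theorem det_lt_det_add {P V : Matrix n n ℂ} (hP : P.PosDef) (hV : V.PosSemidef) (hne : V ≠ 0) :
    P.det.re < (P + V).det.re := by
  obtain ⟨L, hL, hPL⟩ := exists_isUnit_conjTranspose_mul_self hP
  have hLd : IsUnit L.det := (Matrix.isUnit_iff_isUnit_det _).1 hL
  have hLd' : IsUnit Lᴴ.det := by simpa [det_conjTranspose] using hLd
  have hLd2 : Lᴴ * (L⁻¹)ᴴ = 1 := by
    rw [← conjTranspose_mul, nonsing_inv_mul _ hLd, conjTranspose_one]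
  set V' := (L⁻¹)ᴴ * V * L⁻¹ with hV'
  have h1 : Lᴴ * V' * L = V := by
    calc Lᴴ * V' * L = (Lᴴ * (L⁻¹)ᴴ) * V * (L⁻¹ * L) := by simp only [hV', Matrix.mul_assoc]
      _ = V := by rw [hLd2, nonsing_inv_mul _ hLd]; simp
  have h2 : P + V = Lᴴ * (1 + V') * L := by
    rw [Matrix.mul_add, Matrix.add_mul, h1, Matrix.mul_one, hPL]
  have h3 : (P + V).det = P.det * (1 + V').det := by
    rw [h2, hPL]; simp only [det_mul]; ring
  have h4 : V' ≠ 0 := by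
    intro h0; apply hne; rw [← h1, h0]; simp
  have h5 := det_one_add_ge (hV.conjTranspose_mul_mul_same L⁻¹) h4
  have h6 := hP.det_pos
  rw [Complex.pos_iff] at h6
  rw [h3, Complex.mul_re, ← h6.2]
  nlinarith [h6.1]

theorem PosDef.eq_zero_of_conjTranspose_mul_mul_eq_zero {m : Type*} {G : Matrix n n ℂ} (hG : G.PosDef)
    {D : Matrix n m ℂ} (h : Dᴴ * G * D = 0) : D = 0 := by
  obtain ⟨L, hL, rfl⟩ := exists_isUnit_conjTranspose_mul_self hG
  have h1 : (L * D)ᴴ * (L * D) = 0 := by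
    rw [conjTranspose_mul, ← h]; simp only [Matrix.mul_assoc]
  have h2 := conjTranspose_mul_self_eq_zero.1 h1
  have hLd : IsUnit L.det := (Matrix.isUnit_iff_isUnit_det _).1 hL
  calc D = L⁻¹ * (L * D) := by rw [← Matrix.mul_assoc, nonsing_inv_mul _ hLd, Matrix.one_mul]
    _ = 0 := by rw [h2, Matrix.mul_zero]

theorem trace_re_conjTranspose_mul_mul_pos {m : Type*} [Fintype m] {G : Matrix n n ℂ} (hG : G.PosDef)
    {D : Matrix n m ℂ} (h : D ≠ 0) : 0 < (Dᴴ * G * D).trace.re := by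
  have h1 := hG.posSemidef.conjTranspose_mul_mul_same D
  have h2 := h1.trace_nonneg
  have h3 : (Dᴴ * G * D).trace ≠ 0 := by
    rw [Ne, h1.trace_eq_zero_iff]
    exact fun h0 => h (PosDef.eq_zero_of_conjTranspose_mul_mul_eq_zero hG h0)
  exact (Complex.pos_iff.1 (lt_of_le_of_ne h2 h3.symm)).1

theorem trace_conj_eq {m : Type*} [Fintype m] (P : Matrix m m ℂ) : Pᴴ.trace.re = P.trace.re := by
  rw [trace_conjTranspose]; simp

/-- For fixed scatter matrix `k • V`, the Gaussian likelihood is maximal exactly at covariance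
`V`. -/
theorem likelihood_lt_of_ne {R V : Matrix n n ℂ} (hR : R.PosDef) (hV : V.PosDef) {k : ℕ}
    (hk : k ≠ 0) (hne : R ≠ V) :
    (R.det.re ^ k)⁻¹ * Real.exp (-(R⁻¹ * ((k : ℂ) • V)).trace.re) <
      (V.det.re ^ k)⁻¹ * Real.exp (-(V⁻¹ * ((k : ℂ) • V)).trace.re) := by
  -- With `R⁻¹ = L† L`, the matrix `L V L†` has determinant `det V / det R` and trace `Tr(R⁻¹ V)`.
  -- The inequality is then the `k`-th power of `det_mul_exp_neg_trace_lt` for this matrix, divided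
  -- by `det V`.
  obtain ⟨L, hL, hRL⟩ := exists_isUnit_conjTranspose_mul_self hR.inv
  have hLd : IsUnit L.det := (Matrix.isUnit_iff_isUnit_det _).1 hL
  have hRd : IsUnit R.det := (Matrix.isUnit_iff_isUnit_det _).1 hR.isUnit
  have hVd : IsUnit V.det := (Matrix.isUnit_iff_isUnit_det _).1 hV.isUnit
  have hU : (L * V * Lᴴ).PosDef := hV.mul_mul_conjTranspose_same
    (Matrix.vecMul_injective_iff_isUnit.2 hL)
  have hUne : L * V * Lᴴ ≠ 1 := by
    intro h
    apply hne
    have h1 : (V * Lᴴ) * L = 1 := by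
      rw [mul_eq_one_comm, ← Matrix.mul_assoc, h]
    rw [Matrix.mul_assoc, ← hRL] at h1
    calc R = (V * R⁻¹) * R := by rw [h1, Matrix.one_mul]
      _ = V := by rw [Matrix.mul_assoc, nonsing_inv_mul _ hRd, Matrix.mul_one]
  have key := det_mul_exp_neg_trace_lt hU hUne
  have htr : (L * V * Lᴴ).trace = (R⁻¹ * V).trace := by
    rw [hRL, Matrix.trace_mul_comm, Matrix.mul_assoc]
  have hdet : (L * V * Lᴴ).det = R.det⁻¹ * V.det := by
    have : R⁻¹.det = R.det⁻¹ := by rw [Matrix.det_nonsing_inv, Ring.inverse_eq_inv']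
    rw [← this, hRL]; simp only [det_mul]; ring
  have hRp := Complex.pos_iff.1 hR.det_pos
  have hVp := Complex.pos_iff.1 hV.det_pos
  have hRe : R.det = ((R.det.re : ℝ) : ℂ) := Complex.ext rfl (by simp [← hRp.2])
  have hVe : V.det = ((V.det.re : ℝ) : ℂ) := Complex.ext rfl (by simp [← hVp.2])
  have hdet' : (L * V * Lᴴ).det.re = (R.det.re)⁻¹ * V.det.re := by
    rw [hdet, hRe, hVe]
    norm_cast
  rw [hdet', htr] at key
  have e1 : (R⁻¹ * ((k : ℂ) • V)).trace.re = k * (R⁻¹ * V).trace.re := by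
    rw [Matrix.mul_smul, trace_smul]; simp
  have e2 : (V⁻¹ * ((k : ℂ) • V)).trace.re = k * Fintype.card n := by
    rw [Matrix.mul_smul, trace_smul, nonsing_inv_mul _ hVd]; simp
  rw [e1, e2, ← mul_neg, ← mul_neg, Real.exp_nat_mul, Real.exp_nat_mul, ← inv_pow, ← inv_pow,
    ← mul_pow, ← mul_pow]
  refine pow_lt_pow_left₀ ?_ (by have := hRp.1; positivity) hk
  have := hVp.1
  calc _ = (V.det.re)⁻¹ * ((R.det.re)⁻¹ * V.det.re * Real.exp (-(R⁻¹ * V).trace.re)) := by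
        field_simp
    _ < _ := by gcongr

end MatrixFacts

/-! ### Generalized least squares -/

section GLS

variable {n e m : Type*} [Fintype n] [DecidableEq n] [Fintype e] [DecidableEq e]

/-- The generalized least squares operator `(E† S⁻¹ E)⁻¹ E† S⁻¹`. -/
noncomputable def glsCoef (S : Matrix n n ℂ) (E : Matrix n e ℂ) : Matrix e n ℂ :=
  (Eᴴ * S⁻¹ * E)⁻¹ * (Eᴴ * S⁻¹)

/-- The generalized least squares residual. -/
noncomputable def glsResid (S : Matrix n n ℂ) (E : Matrix n e ℂ) (Y : Matrix n m ℂ) :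
    Matrix n m ℂ :=
  Y - E * (glsCoef S E * Y)

/-- The generalized least squares energy `Tr[X† S⁻¹ E (E† S⁻¹ E)⁻¹ E† S⁻¹ X]`. -/
noncomputable def glsEnergy [Fintype m] (S : Matrix n n ℂ) (E : Matrix n e ℂ)
    (X : Matrix n m ℂ) : ℂ :=
  (Xᴴ * S⁻¹ * E * (glsCoef S E * X)).trace

theorem mulVec_injective_of_conjTranspose_mul_self {l : Type*} [Fintype l] {E : Matrix l e ℂ}
    (hE : Eᴴ * E = 1) :
    Function.Injective E.mulVec :=
  Function.LeftInverse.injective (g := Eᴴ.mulVec) fun x => by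
    rw [mulVec_mulVec, hE, one_mulVec]

variable {S : Matrix n n ℂ} {E : Matrix n e ℂ}

theorem gram_posDef (hS : S.PosDef) (hE : Eᴴ * E = 1) : (Eᴴ * S⁻¹ * E).PosDef :=
  hS.inv.conjTranspose_mul_mul_same (mulVec_injective_of_conjTranspose_mul_self hE)

theorem PosDef.isUnit_det (hS : S.PosDef) : IsUnit S.det :=
  (Matrix.isUnit_iff_isUnit_det _).1 hS.isUnit

theorem gram_mul_glsCoef (hS : S.PosDef) (hE : Eᴴ * E = 1) :
    Eᴴ * S⁻¹ * E * glsCoef S E = Eᴴ * S⁻¹ := by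
  rw [glsCoef, mul_nonsing_inv_cancel_left _ _ (PosDef.isUnit_det (gram_posDef hS hE))]

theorem glsCoef_mul_self (hS : S.PosDef) (hE : Eᴴ * E = 1) : glsCoef S E * E = 1 := by
  rw [glsCoef, Matrix.mul_assoc, nonsing_inv_mul _ (PosDef.isUnit_det (gram_posDef hS hE))]

theorem conjTranspose_mul_inv_mul_glsResid (hS : S.PosDef) (hE : Eᴴ * E = 1)
    (Y : Matrix n m ℂ) : Eᴴ * S⁻¹ * glsResid S E Y = 0 := by
  rw [glsResid, Matrix.mul_sub, ← Matrix.mul_assoc, ← Matrix.mul_assoc, gram_mul_glsCoef hS hE,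
    sub_self]

/-- The residual is orthogonal to the range of `E` in the metric `S⁻¹`, so both cross terms vanish.
-/
theorem gls_pythagoras (hS : S.PosDef) (hE : Eᴴ * E = 1) (Y : Matrix n m ℂ) (B : Matrix e m ℂ) :
    (Y - E * B)ᴴ * S⁻¹ * (Y - E * B) =
      (glsResid S E Y)ᴴ * S⁻¹ * glsResid S E Y +
        (B - glsCoef S E * Y)ᴴ * (Eᴴ * S⁻¹ * E) * (B - glsCoef S E * Y) := by
  have h1 := conjTranspose_mul_inv_mul_glsResid hS hE Y
  have h2 : (glsResid S E Y)ᴴ * S⁻¹ * E = 0 := by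
    have := congrArg conjTranspose h1
    rwa [conjTranspose_mul, conjTranspose_mul, hS.inv.isHermitian.eq, conjTranspose_conjTranspose,
      conjTranspose_zero, ← Matrix.mul_assoc] at this
  set D := B - glsCoef S E * Y with hD
  set X := glsResid S E Y with hX
  have h3 : Y - E * B = X - E * D := by
    rw [hX, hD, glsResid, Matrix.mul_sub]; abel
  have h4 : Xᴴ * S⁻¹ * (E * D) = 0 := by rw [← Matrix.mul_assoc, h2, Matrix.zero_mul]
  have h5 : Dᴴ * Eᴴ * S⁻¹ * X = 0 := by
    rw [Matrix.mul_assoc, Matrix.mul_assoc, ← Matrix.mul_assoc Eᴴ, h1, Matrix.mul_zero]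
  rw [h3, conjTranspose_sub, conjTranspose_mul]
  simp only [Matrix.sub_mul, Matrix.mul_sub, h4, h5]
  simp only [Matrix.mul_assoc]
  abel

/-- The scatter matrix of the residual is orthogonal to the fitted subspace in the residual
metric as well. -/
theorem conjTranspose_mul_inv_add_mul_glsResid [Fintype m] (hS : S.PosDef) (hE : Eᴴ * E = 1)
    (Y : Matrix n m ℂ) :
    Eᴴ * (S + glsResid S E Y * (glsResid S E Y)ᴴ)⁻¹ * glsResid S E Y = 0 := by
  have h1 := conjTranspose_mul_inv_mul_glsResid hS hE Y
  set X := glsResid S E Y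
  have hW : (S + X * Xᴴ).PosDef := hS.add_posSemidef (posSemidef_self_mul_conjTranspose X)
  -- Since `E† S⁻¹ X = 0`, adding `X X†` to `S` leaves `E† S⁻¹` unchanged.
  have h2 : Eᴴ * S⁻¹ * (S + X * Xᴴ) = Eᴴ := by
    rw [Matrix.mul_add, ← Matrix.mul_assoc, h1, Matrix.zero_mul, add_zero, Matrix.mul_assoc,
      nonsing_inv_mul _ (PosDef.isUnit_det hS), Matrix.mul_one]
  have h3 : Eᴴ * (S + X * Xᴴ)⁻¹ = Eᴴ * S⁻¹ := by
    conv_lhs => rw [← h2]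
    rw [Matrix.mul_assoc, mul_nonsing_inv _ (PosDef.isUnit_det hW), Matrix.mul_one]
  rw [h3, h1]

theorem inv_conj_eq (T S : Matrix n n ℂ) : (T * S * Tᴴ)⁻¹ = (T⁻¹)ᴴ * S⁻¹ * T⁻¹ := by
  rw [Matrix.mul_inv_rev, Matrix.mul_inv_rev, conjTranspose_nonsing_inv, Matrix.mul_assoc]

/-- Equivariance of generalized least squares. -/
theorem glsCoef_conj {T : Matrix n n ℂ} {u : Matrix e e ℂ} (hT : IsUnit T.det)
    (hu : IsUnit u.det) (hTE : T * E = E * u) :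
    glsCoef (T * S * Tᴴ) E = u * glsCoef S E * T⁻¹ := by
  have h1 : T⁻¹ * E = E * u⁻¹ := by
    calc T⁻¹ * E = T⁻¹ * (E * u) * u⁻¹ := by
          rw [Matrix.mul_assoc, Matrix.mul_assoc, mul_nonsing_inv _ hu, Matrix.mul_one]
      _ = E * u⁻¹ := by rw [← hTE, ← Matrix.mul_assoc T⁻¹, nonsing_inv_mul _ hT, Matrix.one_mul]
  have h2 : Eᴴ * (T⁻¹)ᴴ = (u⁻¹)ᴴ * Eᴴ := by
    rw [← conjTranspose_mul, h1, conjTranspose_mul]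
  have h3 : Eᴴ * (T * S * Tᴴ)⁻¹ = (u⁻¹)ᴴ * (Eᴴ * S⁻¹ * T⁻¹) := by
    rw [inv_conj_eq, ← Matrix.mul_assoc, ← Matrix.mul_assoc, h2]; simp only [Matrix.mul_assoc]
  have hui : IsUnit (u⁻¹).det := (isUnit_nonsing_inv_det_iff).2 hu
  have huh : IsUnit ((u⁻¹)ᴴ).det := by simpa [det_conjTranspose] using hui
  have h4 : Eᴴ * (T * S * Tᴴ)⁻¹ * E = (u⁻¹)ᴴ * ((Eᴴ * S⁻¹ * E) * u⁻¹) := by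
    rw [h3]; simp only [Matrix.mul_assoc, h1]
  rw [glsCoef, h4, h3, Matrix.mul_inv_rev, Matrix.mul_inv_rev, nonsing_inv_nonsing_inv _ hu,
    Matrix.mul_assoc, nonsing_inv_mul_cancel_left _ _ huh, glsCoef]
  simp only [Matrix.mul_assoc]

/-- The added term `E b` is fitted exactly and leaves no trace in the residual. This is how the
unknown interference will drop out. -/
theorem glsResid_conj (hS : S.PosDef) (hE : Eᴴ * E = 1) {T : Matrix n n ℂ} {u : Matrix e e ℂ}
    (hT : IsUnit T.det) (hu : IsUnit u.det) (hTE : T * E = E * u) (Y : Matrix n m ℂ)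
    (b : Matrix e m ℂ) :
    glsResid (T * S * Tᴴ) E (T * Y + E * b) = T * glsResid S E Y := by
  have h1 : T⁻¹ * E = E * u⁻¹ := by
    calc T⁻¹ * E = T⁻¹ * (E * u) * u⁻¹ := by
          rw [Matrix.mul_assoc, Matrix.mul_assoc, mul_nonsing_inv _ hu, Matrix.mul_one]
      _ = E * u⁻¹ := by rw [← hTE, ← Matrix.mul_assoc T⁻¹, nonsing_inv_mul _ hT, Matrix.one_mul]
  have h2 : T⁻¹ * (T * Y + E * b) = Y + E * (u⁻¹ * b) := by
    rw [Matrix.mul_add, nonsing_inv_mul_cancel_left _ _ hT, ← Matrix.mul_assoc, h1,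
      Matrix.mul_assoc]
  have h3 : glsCoef S E * (E * (u⁻¹ * b)) = u⁻¹ * b := by
    rw [← Matrix.mul_assoc, glsCoef_mul_self hS hE, Matrix.one_mul]
  rw [glsResid, glsCoef_conj hT hu hTE, Matrix.mul_assoc, h2, Matrix.mul_assoc u, Matrix.mul_add,
    h3, Matrix.mul_add, mul_nonsing_inv_cancel_left _ _ hu, Matrix.mul_add, ← Matrix.mul_assoc E u,
    ← hTE, glsResid, Matrix.mul_sub]
  simp only [Matrix.mul_assoc]
  abel

theorem glsEnergy_conj [Fintype m] {T : Matrix n n ℂ} {u : Matrix e e ℂ}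
    (hT : IsUnit T.det) (hu : IsUnit u.det) (hTE : T * E = E * u) (X : Matrix n m ℂ) :
    glsEnergy (T * S * Tᴴ) E (T * X) = glsEnergy S E X := by
  have hTh : IsUnit (Tᴴ).det := by simpa [det_conjTranspose] using hT
  rw [glsEnergy, glsCoef_conj hT hu hTE, inv_conj_eq, conjTranspose_mul]
  have e1 : Tᴴ * (T⁻¹)ᴴ = 1 := by
    rw [← conjTranspose_mul, nonsing_inv_mul _ hT, conjTranspose_one]
  have e2 : Xᴴ * Tᴴ * ((T⁻¹)ᴴ * S⁻¹ * T⁻¹) = Xᴴ * S⁻¹ * T⁻¹ := by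
    calc _ = Xᴴ * (Tᴴ * (T⁻¹)ᴴ) * S⁻¹ * T⁻¹ := by simp only [Matrix.mul_assoc]
      _ = _ := by rw [e1, Matrix.mul_one]
  rw [e2, glsEnergy]
  congr 1
  calc _ = Xᴴ * S⁻¹ * (T⁻¹ * (E * u)) * (glsCoef S E * (T⁻¹ * T) * X) := by
        simp only [Matrix.mul_assoc]
    _ = _ := by rw [← hTE, nonsing_inv_mul_cancel_left _ _ hT, nonsing_inv_mul _ hT,
                  Matrix.mul_one]

/-- The energy is the trace of a positive semidefinite matrix. This lets the closed form be stated
as an equality of complex numbers. -/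
theorem glsEnergy_eq_ofReal [Fintype m] (hS : S.PosDef) (hE : Eᴴ * E = 1) (X : Matrix n m ℂ) :
    glsEnergy S E X = ((glsEnergy S E X).re : ℂ) := by
  have h : ((Eᴴ * S⁻¹ * X)ᴴ * (Eᴴ * S⁻¹ * E)⁻¹ * (Eᴴ * S⁻¹ * X)).PosSemidef :=
    (gram_posDef hS hE).inv.posSemidef.conjTranspose_mul_mul_same _
  have h2 : glsEnergy S E X =
      ((Eᴴ * S⁻¹ * X)ᴴ * (Eᴴ * S⁻¹ * E)⁻¹ * (Eᴴ * S⁻¹ * X)).trace := by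
    rw [glsEnergy, glsCoef, conjTranspose_mul, conjTranspose_mul, hS.inv.isHermitian.eq,
      conjTranspose_conjTranspose]
    simp only [Matrix.mul_assoc]
  have h3 := (Complex.nonneg_iff.1 h.trace_nonneg).2
  rw [h2]
  exact Complex.ext rfl h3.symm

end GLS

/-! ### The canonical model -/

theorem conjTranspose_mul_Et {N t : ℕ} (h : t ≤ N) {m : Type*} (Y : Matrix (Fin N) m ℂ)
    (i : Fin t) (j : m) : ((Et N t)ᴴ * Y) i j = Y (Fin.castLE h i) j := by
  rw [Matrix.mul_apply, Finset.sum_eq_single (Fin.castLE h i)]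
  · simp [Et]
  · intro b _ hb
    have : (b : ℕ) ≠ i := fun h' => hb (Fin.ext h')
    simp [Et, this]
  · simp

theorem conjTranspose_mul_Er {N t r : ℕ} (h : t + r ≤ N) {m : Type*} (Y : Matrix (Fin N) m ℂ)
    (i : Fin r) (j : m) :
    ((Er N t r)ᴴ * Y) i j = Y (Fin.castLE h (Fin.natAdd t i)) j := by
  rw [Matrix.mul_apply, Finset.sum_eq_single (Fin.castLE h (Fin.natAdd t i))]
  · simp [Er]
  · intro b _ hb
    have : (b : ℕ) ≠ t + i := fun h' => hb (Fin.ext (by simpa using h'))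
    simp [Er, this]
  · simp

theorem Et_gram {N t : ℕ} (h : t ≤ N) : (Et N t)ᴴ * Et N t = 1 := by
  ext i j
  rw [conjTranspose_mul_Et h]
  simp [Et, Matrix.one_apply, Fin.ext_iff]

theorem Er_gram {N t r : ℕ} (h : t + r ≤ N) : (Er N t r)ᴴ * Er N t r = 1 := by
  ext i j
  rw [conjTranspose_mul_Er h]
  simp [Er, Matrix.one_apply, Fin.ext_iff]

theorem Et_Er_gram {N t r : ℕ} (h : t + r ≤ N) : (Et N t)ᴴ * Er N t r = 0 := by
  ext i j
  rw [conjTranspose_mul_Et (by omega)]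
  have : (i : ℕ) ≠ t + j := by have := i.2; omega
  simp [Er, this]

theorem leftA_gram {N t r : ℕ} (h : t + r ≤ N) : (leftA N t r)ᴴ * leftA N t r = 1 := by
  have h1 : (Er N t r)ᴴ * Et N t = 0 := by
    rw [← conjTranspose_conjTranspose (Et N t), ← conjTranspose_mul, Et_Er_gram h,
      conjTranspose_zero]
  rw [leftA, conjTranspose_fromCols_eq_fromRows_conjTranspose, fromRows_mul_fromCols,
    Et_gram (by omega), Er_gram h, Et_Er_gram h, h1, fromBlocks_one]

theorem rightC_gram {M K : ℕ} (h : M ≤ K) : rightC M K * (rightC M K)ᴴ = 1 := by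
  have : rightC M K = (Et K M)ᴴ := by
    ext i j
    simp only [rightC, Et, of_apply, conjTranspose_apply, eq_comm]
    split_ifs <;> simp
  rw [this, conjTranspose_conjTranspose, Et_gram h]

theorem leftA_mul_fromRows {N t r M : ℕ} (B : Matrix (Fin t) (Fin M) ℂ)
    (B' : Matrix (Fin r) (Fin M) ℂ) :
    leftA N t r * Matrix.fromRows B B' = Et N t * B + Er N t r * B' := by
  rw [leftA, fromCols_mul_fromRows]

theorem proj_rightC {M K : ℕ} (h : M ≤ K) :
    proj (rightC M K)ᴴ = (rightC M K)ᴴ * rightC M K := by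
  rw [proj, conjTranspose_conjTranspose, rightC_gram h, inv_one, Matrix.mul_one]

variable {N K t r M : ℕ}

/-- The data seen in the signal columns. -/
noncomputable def sigCols (M : ℕ) (Z : Matrix (Fin N) (Fin K) ℂ) : Matrix (Fin N) (Fin M) ℂ :=
  Z * (rightC M K)ᴴ

theorem Sc_eq (h : M ≤ K) (Z : Matrix (Fin N) (Fin K) ℂ) :
    Sc M Z = Z * Zᴴ - sigCols M Z * (sigCols M Z)ᴴ := by
  rw [Sc, proj_rightC h, sigCols, conjTranspose_mul, conjTranspose_conjTranspose]
  simp only [Matrix.mul_sub, Matrix.sub_mul, Matrix.mul_assoc, Matrix.one_mul]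

/-- The scatter matrix about a mean supported on the signal columns. -/
theorem scatter_eq (h : M ≤ K) (Z : Matrix (Fin N) (Fin K) ℂ) (D : Matrix (Fin N) (Fin M) ℂ) :
    (Z - D * rightC M K) * (Z - D * rightC M K)ᴴ =
      Sc M Z + (sigCols M Z - D) * (sigCols M Z - D)ᴴ := by
  have h1 : D * rightC M K * ((rightC M K)ᴴ * Dᴴ) = D * Dᴴ := by
    rw [Matrix.mul_assoc, ← Matrix.mul_assoc (rightC M K), rightC_gram h, Matrix.one_mul]
  rw [Sc_eq h]
  simp only [sigCols, conjTranspose_sub, conjTranspose_mul, conjTranspose_conjTranspose,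
    Matrix.mul_sub, Matrix.sub_mul, h1, Matrix.mul_assoc]
  abel

/-- The square roots cancel in pairs, as `A₀† A₀ = E_t† S_c⁻¹ E_t`. The conjugated projection is the
least squares fit in the metric `S_c⁻¹`. -/
theorem obliqueProj_eq {Z : Matrix (Fin N) (Fin K) ℂ} (hS : (Sc M Z).PosDef) :
    obliqueProj t M Z = Et N t * glsCoef (Sc M Z) (Et N t) := by
  set s := CFC.sqrt (Sc M Z) with hs
  have h0 : 0 ≤ s := CFC.sqrt_nonneg _
  have hss : s * s = Sc M Z := CFC.sqrt_mul_sqrt_self _ hS.posSemidef.nonneg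
  have hsH : sᴴ = s := h0.posSemidef.isHermitian
  have hd : IsUnit s.det := by
    have h1 := PosDef.isUnit_det hS
    rw [← hss, det_mul] at h1
    exact isUnit_of_mul_isUnit_left h1
  have hsi : (s⁻¹)ᴴ = s⁻¹ := by rw [conjTranspose_nonsing_inv, hsH]
  have hii : s⁻¹ * s⁻¹ = (Sc M Z)⁻¹ := by rw [← hss, Matrix.mul_inv_rev]
  rw [obliqueProj, ← hs, proj, conjTranspose_mul, hsi, glsCoef, ← hii]
  calc _ = (s * s⁻¹) * (Et N t * (((Et N t)ᴴ * s⁻¹ * (s⁻¹ * Et N t))⁻¹ *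
        ((Et N t)ᴴ * (s⁻¹ * s⁻¹)))) := by simp only [Matrix.mul_assoc]
    _ = _ := by rw [mul_nonsing_inv _ hd, Matrix.one_mul]; simp only [Matrix.mul_assoc]

/-- Residual of the signal columns after fitting the interference. -/
noncomputable def nullResid (t M : ℕ) (Z : Matrix (Fin N) (Fin K) ℂ) : Matrix (Fin N) (Fin M) ℂ :=
  glsResid (Sc M Z) (Et N t) (sigCols M Z)

theorem sub_obliqueProj_mul {Z : Matrix (Fin N) (Fin K) ℂ} (hS : (Sc M Z).PosDef) :
    (Z - obliqueProj t M Z * Z) * (rightC M K)ᴴ = nullResid t M Z := by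
  rw [obliqueProj_eq hS, nullResid, glsResid, sigCols, Matrix.sub_mul]
  simp only [Matrix.mul_assoc]

theorem R0hat_eq (h : M ≤ K) {Z : Matrix (Fin N) (Fin K) ℂ} (hS : (Sc M Z).PosDef) :
    R0hat t M Z = (K : ℂ)⁻¹ • (Sc M Z + nullResid t M Z * (nullResid t M Z)ᴴ) := by
  rw [R0hat, proj_rightC h, ← sub_obliqueProj_mul hS, conjTranspose_mul,
    conjTranspose_conjTranspose]
  simp only [Matrix.mul_assoc]

theorem natCast_smul_R0hat (h : M + N ≤ K) {Z : Matrix (Fin N) (Fin K) ℂ}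
    (hS : (Sc M Z).PosDef) :
    (K : ℂ) • R0hat t M Z = Sc M Z + nullResid t M Z * (nullResid t M Z)ᴴ := by
  rw [R0hat_eq (by omega) hS, smul_smul]
  -- `K = 0` makes the normalization `K⁻¹` degenerate, but it forces `N = 0`, where all matrices are
  -- empty.
  rcases Nat.eq_zero_or_pos K with h0 | h0
  · have : N = 0 := by omega
    subst this
    exact Subsingleton.elim _ _
  · rw [mul_inv_cancel₀ (by exact_mod_cast h0.ne'), one_smul]

theorem R0hat_posDef (h : M + N ≤ K) {Z : Matrix (Fin N) (Fin K) ℂ} (hS : (Sc M Z).PosDef) :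
    (R0hat t M Z).PosDef := by
  rcases Nat.eq_zero_or_pos K with h0 | h0
  · have : N = 0 := by omega
    subst this
    rwa [Subsingleton.elim (R0hat t M Z) (Sc M Z)]
  · rw [R0hat_eq (by omega) hS]
    refine PosDef.smul (hS.add_posSemidef (posSemidef_self_mul_conjTranspose _)) ?_
    have : (0 : ℝ) < (K : ℝ)⁻¹ := by positivity
    have := Complex.zero_lt_real.2 this
    simpa using this

/-- This is the likelihood equation for the interference at the null estimate. Orthogonality passes
from the metric `S_c⁻¹` to that of the full scatter matrix, and the factor `K⁻¹` is harmless. -/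
theorem Et_R0hat_inv_nullResid (ht : t ≤ N) (h : M + N ≤ K) {Z : Matrix (Fin N) (Fin K) ℂ}
    (hS : (Sc M Z).PosDef) :
    (Et N t)ᴴ * (R0hat t M Z)⁻¹ * nullResid t M Z = 0 := by
  have h1 := conjTranspose_mul_inv_add_mul_glsResid hS (Et_gram ht) (sigCols M Z)
  rcases Nat.eq_zero_or_pos K with h0 | h0
  · have : N = 0 := by omega
    subst this
    have : t = 0 := by omega
    subst this
    exact Subsingleton.elim _ _
  · rw [R0hat_eq (by omega) hS]
    have hK : (K : ℂ)⁻¹ ≠ 0 := by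
      have : (K : ℂ) ≠ 0 := by exact_mod_cast h0.ne'
      exact inv_ne_zero this
    have hW : (Sc M Z + nullResid t M Z * (nullResid t M Z)ᴴ).PosDef :=
      hS.add_posSemidef (posSemidef_self_mul_conjTranspose _)
    have := Matrix.inv_smul' (Sc M Z + nullResid t M Z * (nullResid t M Z)ᴴ) (Units.mk0 _ hK)
      (PosDef.isUnit_det hW)
    rw [Units.smul_def, Units.val_mk0] at this
    rw [this, Units.smul_def, Matrix.mul_smul, Matrix.smul_mul]
    change _ • ((Et N t)ᴴ * (Sc M Z + glsResid (Sc M Z) (Et N t) (sigCols M Z) *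
      (glsResid (Sc M Z) (Et N t) (sigCols M Z))ᴴ)⁻¹ * glsResid (Sc M Z) (Et N t) (sigCols M Z)) = 0
    rw [h1, smul_zero]

/-- The interference rows of `A† R̂₀⁻¹ X` are zero, so only the lower right block of `(A† R̂₀⁻¹
A)⁻¹` contributes to the energy. The projection `P_{C†} = C† C` is absorbed by cyclicity of the
trace, since `Z_{d,0} C† = X`. -/
theorem raoTrace_eq (hJ : t + r ≤ N) (h : M + N ≤ K) {Z : Matrix (Fin N) (Fin K) ℂ}
    (hS : (Sc M Z).PosDef) :
    raoTrace t r M Z = glsEnergy (R0hat t M Z) (leftA N t r) (nullResid t M Z) := by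
  have hX := Et_R0hat_inv_nullResid (show t ≤ N by omega) h hS
  have hRH : ((R0hat t M Z)⁻¹)ᴴ = (R0hat t M Z)⁻¹ :=
    (R0hat_posDef h hS).inv.isHermitian
  have hZd : Zd0 t M Z * (rightC M K)ᴴ = nullResid t M Z := by
    rw [Zd0, proj_rightC (by omega), ← sub_obliqueProj_mul hS, Matrix.sub_mul, Matrix.sub_mul,
      Matrix.mul_assoc (obliqueProj t M Z * Z), Matrix.mul_assoc (rightC M K)ᴴ,
      rightC_gram (by omega), Matrix.mul_one]
  set R := R0hat t M Z
  set X := nullResid t M Z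
  have h1 : (leftA N t r)ᴴ * R⁻¹ * X = Matrix.fromRows 0 ((Er N t r)ᴴ * R⁻¹ * X) := by
    rw [leftA, conjTranspose_fromCols_eq_fromRows_conjTranspose, fromRows_mul, fromRows_mul, hX]
  have h2 : Xᴴ * R⁻¹ * leftA N t r = Matrix.fromCols 0 (Xᴴ * R⁻¹ * Er N t r) := by
    have := congrArg conjTranspose h1
    rw [conjTranspose_fromRows_eq_fromCols_conjTranspose] at this
    simpa only [conjTranspose_mul, conjTranspose_conjTranspose, hRH, conjTranspose_zero,
      ← Matrix.mul_assoc] using this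
  have h3 : glsEnergy R (leftA N t r) X =
      (Xᴴ * R⁻¹ * Er N t r * (gammaHat t r M Z).toBlocks₂₂ * ((Er N t r)ᴴ * R⁻¹ * X)).trace := by
    rw [glsEnergy, glsCoef, Matrix.mul_assoc _ _ X, h1, h2]
    change Matrix.trace (Matrix.fromCols (0 : Matrix (Fin M) (Fin t) ℂ) (Xᴴ * R⁻¹ * Er N t r) *
      (gammaHat t r M Z * Matrix.fromRows (0 : Matrix (Fin t) (Fin M) ℂ)
        ((Er N t r)ᴴ * R⁻¹ * X))) = _
    rw [← fromBlocks_toBlocks (gammaHat t r M Z), fromBlocks_mul_fromRows, fromCols_mul_fromRows]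
    simp [Matrix.mul_assoc]
  rw [h3, raoTrace, proj_rightC (by omega), ← hZd, conjTranspose_mul, conjTranspose_conjTranspose,
    ← Matrix.mul_assoc, trace_mul_comm]
  simp only [Matrix.mul_assoc]
  rfl

/-! ### Real coordinates of the parameters -/

section Coordinates

variable {p : ℕ}

/-- Real coordinates of a complex matrix. -/
def matEnc (B : Matrix (Fin p) (Fin M) ℂ) : VecIdx p M → ℝ :=
  Sum.elim (fun k => (B k.2 k.1).re) (fun k => (B k.2 k.1).im)

@[simp] theorem matOf_matEnc (B : Matrix (Fin p) (Fin M) ℂ) : matOf (matEnc B) = B := by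
  ext i j; simp [matOf, matEnc]

@[simp] theorem matEnc_matOf (x : VecIdx p M → ℝ) : matEnc (matOf x) = x := by
  ext (k | k) <;> simp [matOf, matEnc]

theorem matOf_injective : Function.Injective (matOf : (VecIdx p M → ℝ) → _) :=
  Function.LeftInverse.injective matEnc_matOf

/-- Real coordinates of a Hermitian matrix. -/
def covEnc (R : Matrix (Fin N) (Fin N) ℂ) : Fin N × Fin N → ℝ :=
  fun k => if k.1 ≤ k.2 then (R k.1 k.2).re else (R k.2 k.1).im

theorem covOf_isHermitian (x : Fin N × Fin N → ℝ) : (covOf x).IsHermitian := by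
  ext i j
  rcases lt_trichotomy i j with h | h | h
  · simp [covOf, h, h.ne, h.ne', h.not_gt, Complex.ext_iff]
  · subst h; simp [covOf, Complex.ext_iff]
  · simp [covOf, h, h.ne, h.ne', h.not_gt, Complex.ext_iff]

theorem covOf_covEnc {R : Matrix (Fin N) (Fin N) ℂ} (hR : R.IsHermitian) :
    covOf (covEnc R) = R := by
  ext i j
  have hij := hR.apply i j
  rw [Complex.ext_iff] at hij
  simp only [Complex.star_def, Complex.conj_re, Complex.conj_im] at hij
  rcases lt_trichotomy i j with h | h | h
  · simp [covOf, covEnc, h, h.ne, h.le, h.not_ge]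
  · subst h
    have : (R i i).im = 0 := by linarith [hij.2]
    simp [covOf, covEnc, Complex.ext_iff, this]
  · simp [covOf, covEnc, h.ne', h.le, h.not_gt, h.not_ge, hij.1, hij.2]

theorem covEnc_covOf (x : Fin N × Fin N → ℝ) : covEnc (covOf x) = x := by
  ext ⟨i, j⟩
  rcases lt_trichotomy i j with h | h | h
  · simp [covOf, covEnc, h, h.ne, h.le]
  · subst h; simp [covOf, covEnc]
  · simp [covOf, covEnc, h, h.ne, h.not_ge]

theorem covOf_injective : Function.Injective (covOf : (Fin N × Fin N → ℝ) → _) :=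
  Function.LeftInverse.injective covEnc_covOf

/-- Real coordinates of an interference matrix and a covariance matrix. -/
def nuisEnc (B : Matrix (Fin t) (Fin M) ℂ) (R : Matrix (Fin N) (Fin N) ℂ) : NuisIdx t M N → ℝ :=
  Sum.elim (matEnc B) (covEnc R)

@[simp] theorem nuisB_nuisEnc (B : Matrix (Fin t) (Fin M) ℂ) (R : Matrix (Fin N) (Fin N) ℂ) :
    nuisB (nuisEnc B R) = B := matOf_matEnc B

theorem nuisR_nuisEnc (B : Matrix (Fin t) (Fin M) ℂ) {R : Matrix (Fin N) (Fin N) ℂ}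
    (hR : R.IsHermitian) : nuisR (nuisEnc B R) = R := covOf_covEnc hR

theorem nuis_ext {x y : NuisIdx t M N → ℝ} (hB : nuisB x = nuisB y) (hR : nuisR x = nuisR y) :
    x = y := by
  have h1 := matOf_injective hB
  have h2 := covOf_injective hR
  ext (k | k)
  · exact congrFun h1 k
  · exact congrFun h2 k

end Coordinates

/-! ### Maximum likelihood -/

theorem gaussDensity_signal (h : M ≤ K) (Z : Matrix (Fin N) (Fin K) ℂ)
    (D : Matrix (Fin N) (Fin M) ℂ) (R : Matrix (Fin N) (Fin N) ℂ) :
    gaussDensity Z (D * rightC M K) R = (Real.pi ^ (N * K))⁻¹ * ((R.det.re ^ K)⁻¹ *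
      Real.exp (-(R⁻¹ * (Sc M Z + (sigCols M Z - D) * (sigCols M Z - D)ᴴ)).trace.re)) := by
  rw [gaussDensity, Matrix.mul_assoc R⁻¹, scatter_eq h, mul_assoc]

/-- The interference estimate under the null hypothesis. -/
noncomputable def nullB (t M : ℕ) (Z : Matrix (Fin N) (Fin K) ℂ) : Matrix (Fin t) (Fin M) ℂ :=
  glsCoef (Sc M Z) (Et N t) * sigCols M Z

theorem sigCols_sub_nullB (Z : Matrix (Fin N) (Fin K) ℂ) :
    sigCols M Z - Et N t * nullB t M Z = nullResid t M Z := rfl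

theorem scatter_posDef {Z : Matrix (Fin N) (Fin K) ℂ} (hS : (Sc M Z).PosDef)
    (Y : Matrix (Fin N) (Fin M) ℂ) : (Sc M Z + Y * Yᴴ).PosDef :=
  hS.add_posSemidef (posSemidef_self_mul_conjTranspose _)

/-- The identity `det(S + X X†) = det S · det(1 + X† S⁻¹ X)` exposes the quadratic form of
`gls_pythagoras`. Moving away from the least squares fit adds a nonzero positive semidefinite term
inside the determinant. -/
theorem det_scatter_lt (ht : t ≤ N) {Z : Matrix (Fin N) (Fin K) ℂ} (hS : (Sc M Z).PosDef)
    {B : Matrix (Fin t) (Fin M) ℂ} (hB : B ≠ nullB t M Z) :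
    (Sc M Z + nullResid t M Z * (nullResid t M Z)ᴴ).det.re <
      (Sc M Z + (sigCols M Z - Et N t * B) * (sigCols M Z - Et N t * B)ᴴ).det.re := by
  have hG := gram_posDef hS (Et_gram ht)
  have hD : (B - nullB t M Z) ≠ 0 := sub_ne_zero.2 hB
  have hSp := Complex.pos_iff.1 hS.det_pos
  rw [det_add_mul _ _ (PosDef.isUnit_det hS), det_add_mul _ _ (PosDef.isUnit_det hS),
    gls_pythagoras hS (Et_gram ht), ← add_assoc, Complex.mul_re, Complex.mul_re, ← hSp.2,
    zero_mul, sub_zero, zero_mul, sub_zero]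
  refine mul_lt_mul_of_pos_left (det_lt_det_add ?_ ?_ ?_) hSp.1
  · exact PosDef.one.add_posSemidef (hS.inv.posSemidef.conjTranspose_mul_mul_same _)
  · exact hG.posSemidef.conjTranspose_mul_mul_same _
  · exact fun h0 => hD (PosDef.eq_zero_of_conjTranspose_mul_mul_eq_zero hG h0)

/-- The likelihood is profiled: first `R` is replaced by the optimal `V` for the given `B`, then `V`
is compared with `R̂₀`. At least one of the two comparisons is strict. -/
theorem f0_lt (ht : t ≤ N) (hK : M + N ≤ K) {Z : Matrix (Fin N) (Fin K) ℂ}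
    (hS : (Sc M Z).PosDef) {B : Matrix (Fin t) (Fin M) ℂ} {R : Matrix (Fin N) (Fin N) ℂ}
    (hR : R.PosDef) (hne : ¬ (B = nullB t M Z ∧ R = R0hat t M Z)) :
    f0 Z B R < f0 Z (nullB t M Z) (R0hat t M Z) := by
  rcases Nat.eq_zero_or_pos K with h0 | h0
  · have : N = 0 := by omega
    subst this
    have : t = 0 := by omega
    subst this
    exact absurd ⟨Subsingleton.elim _ _, Subsingleton.elim _ _⟩ hne
  have hK0 : (K : ℂ) ≠ 0 := by exact_mod_cast h0.ne'
  rw [f0, f0, gaussDensity_signal (by omega), gaussDensity_signal (by omega), sigCols_sub_nullB]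
  refine mul_lt_mul_of_pos_left ?_ (by positivity)
  have hWh := natCast_smul_R0hat (t := t) hK hS
  have hRh := R0hat_posDef (t := t) hK hS
  rw [← hWh]
  set W := Sc M Z + (sigCols M Z - Et N t * B) * (sigCols M Z - Et N t * B)ᴴ with hW
  have hWp : W.PosDef := scatter_posDef hS _
  set V := (K : ℂ)⁻¹ • W with hV
  have hVW : (K : ℂ) • V = W := by rw [hV, smul_smul, mul_inv_cancel₀ hK0, one_smul]
  have hVp : V.PosDef := by
    refine PosDef.smul hWp ?_
    have : (0 : ℝ) < (K : ℝ)⁻¹ := by positivity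
    simpa using Complex.zero_lt_real.2 this
  have htr {U : Matrix (Fin N) (Fin N) ℂ} (hU : U.PosDef) :
      (U⁻¹ * ((K : ℂ) • U)).trace.re = K * N := by
    rw [Matrix.mul_smul, trace_smul, nonsing_inv_mul _ (PosDef.isUnit_det hU)]; simp
  have hRd := (Complex.pos_iff.1 hRh.det_pos).1
  have hdet (U : Matrix (Fin N) (Fin N) ℂ) :
      ((K : ℂ) • U).det.re = (K : ℝ) ^ N * U.det.re := by
    rw [det_smul, Fintype.card_fin]
    norm_cast
    rw [← Complex.ofReal_natCast, Complex.re_ofReal_mul]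
  -- At a matched covariance the exponent is `-KN` whatever the covariance, so only the determinants
  -- have to be compared.
  have step2 (hB : B ≠ nullB t M Z) : (V.det.re ^ K)⁻¹ *
      Real.exp (-(V⁻¹ * ((K : ℂ) • V)).trace.re) < ((R0hat t M Z).det.re ^ K)⁻¹ *
      Real.exp (-((R0hat t M Z)⁻¹ * ((K : ℂ) • R0hat t M Z)).trace.re) := by
    rw [htr hVp, htr hRh]
    refine mul_lt_mul_of_pos_right ?_ (Real.exp_pos _)
    have hlt := det_scatter_lt ht hS hB
    rw [← hWh, ← hW, ← hVW, hdet, hdet] at hlt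
    have hlt' := lt_of_mul_lt_mul_left hlt (by positivity)
    gcongr
  by_cases hRV : R = V
  · have hB : B ≠ nullB t M Z := by
      intro hB
      refine hne ⟨hB, ?_⟩
      rw [hRV, hV, hW, hB, sigCols_sub_nullB, R0hat_eq (by omega) hS]
    have := step2 hB
    rwa [← hRV, hRV, hVW, ← hRV] at this
  · have h1 := likelihood_lt_of_ne hR hVp h0.ne' hRV
    rw [hVW] at h1
    by_cases hB : B = nullB t M Z
    · have : V = R0hat t M Z := by
        rw [hV, hW, hB, sigCols_sub_nullB, R0hat_eq (by omega) hS]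
      rw [← this, hVW]
      exact h1
    · have := step2 hB
      rw [hVW] at this
      exact h1.trans this

theorem isNullMLE_iff (ht : t ≤ N) (hK : M + N ≤ K) {Z : Matrix (Fin N) (Fin K) ℂ}
    (hS : (Sc M Z).PosDef) (x : NuisIdx t M N → ℝ) :
    IsNullMLE Z x ↔ x = nuisEnc (nullB t M Z) (R0hat t M Z) := by
  have hRh := R0hat_posDef (t := t) hK hS
  have hR := nuisR_nuisEnc (nullB t M Z) hRh.isHermitian
  constructor
  · rintro ⟨h1, h2⟩
    by_contra hne
    have h3 := h2 (nuisEnc (nullB t M Z) (R0hat t M Z)) (by rwa [hR])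
    rw [hR, nuisB_nuisEnc] at h3
    refine absurd h3 (not_le.2 (f0_lt ht hK hS h1 ?_))
    rintro ⟨hB', hR'⟩
    exact hne (nuis_ext (by rw [hB', nuisB_nuisEnc]) (by rw [hR', hR]))
  · rintro rfl
    refine ⟨by rwa [hR], fun y hy => ?_⟩
    rw [hR, nuisB_nuisEnc]
    by_cases h : nuisB y = nullB t M Z ∧ nuisR y = R0hat t M Z
    · rw [h.1, h.2]
    · exact (f0_lt ht hK hS hy h).le

theorem thetaS0_eq (ht : t ≤ N) (hK : M + N ≤ K) {Z : Matrix (Fin N) (Fin K) ℂ}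
    (hS : (Sc M Z).PosDef) : thetaS0 t M Z = nuisEnc (nullB t M Z) (R0hat t M Z) :=
  (isNullMLE_iff ht hK hS _).1
    (Classical.epsilon_spec ⟨_, (isNullMLE_iff ht hK hS _).2 rfl⟩)

theorem nuisR_thetaS0 (ht : t ≤ N) (hK : M + N ≤ K) {Z : Matrix (Fin N) (Fin K) ℂ}
    (hS : (Sc M Z).PosDef) : nuisR (thetaS0 t M Z) = R0hat t M Z := by
  rw [thetaS0_eq ht hK hS, nuisR_nuisEnc _ (R0hat_posDef hK hS).isHermitian]

theorem nuisB_thetaS0 (ht : t ≤ N) (hK : M + N ≤ K) {Z : Matrix (Fin N) (Fin K) ℂ}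
    (hS : (Sc M Z).PosDef) : nuisB (thetaS0 t M Z) = nullB t M Z := by
  rw [thetaS0_eq ht hK hS, nuisB_nuisEnc]

/-- The signal estimate given the null estimate of the nuisance parameters. -/
noncomputable def restrictedB (t r M : ℕ) (Z : Matrix (Fin N) (Fin K) ℂ) :
    Matrix (Fin r) (Fin M) ℂ :=
  glsCoef (R0hat t M Z) (Er N t r) * nullResid t M Z

/-- The null fit is already subtracted, so the signal is regressed on the null residual `X` in the
metric `R̂₀⁻¹`. The constant collects everything that `gls_pythagoras` separates from the signal. -/
theorem f1_restricted (hJ : t + r ≤ N) (hK : M + N ≤ K) {Z : Matrix (Fin N) (Fin K) ℂ}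
    (hS : (Sc M Z).PosDef) : ∃ c : ℝ, 0 < c ∧ ∀ x : VecIdx r M → ℝ,
    f1 Z (thetaBs (Sum.elim x (thetaS0 t M Z)))
        (thetaR (r := r) (Sum.elim x (thetaS0 t M Z))) =
      c * Real.exp (-((matOf x - restrictedB t r M Z)ᴴ *
        ((Er N t r)ᴴ * (R0hat t M Z)⁻¹ * Er N t r) *
        (matOf x - restrictedB t r M Z)).trace.re) := by
  have hRh := R0hat_posDef (t := t) hK hS
  have hRd := (Complex.pos_iff.1 hRh.det_pos).1
  set R := R0hat t M Z with hRdef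
  refine ⟨(Real.pi ^ (N * K))⁻¹ * ((R.det.re ^ K)⁻¹ * Real.exp (-((R⁻¹ * Sc M Z).trace.re +
    ((glsResid R (Er N t r) (nullResid t M Z))ᴴ * R⁻¹ *
      glsResid R (Er N t r) (nullResid t M Z)).trace.re))), by positivity, fun x => ?_⟩
  have hR : thetaR (r := r) (Sum.elim x (thetaS0 t M Z)) = R := by
    rw [hRdef, ← nuisR_thetaS0 (t := t) (by omega) hK hS]; rfl
  have hB : thetaBs (Sum.elim x (thetaS0 t M Z)) = Matrix.fromRows (nullB t M Z) (matOf x) := by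
    rw [← nuisB_thetaS0 (t := t) (by omega) hK hS]; rfl
  rw [hR, hB, f1, leftA_mul_fromRows, gaussDensity_signal (by omega), ← sub_sub,
    sigCols_sub_nullB, mul_assoc, mul_assoc, ← Real.exp_add, Matrix.mul_add, trace_add,
    ← Matrix.mul_assoc R⁻¹ (_ - _), trace_mul_comm (_ * (_ - _)), ← Matrix.mul_assoc,
    gls_pythagoras hRh (Er_gram hJ), trace_add, Complex.add_re, Complex.add_re, ← neg_add,
    ← add_assoc]
  rfl

theorem isRestrictedMLE_iff (hJ : t + r ≤ N) (hK : M + N ≤ K) {Z : Matrix (Fin N) (Fin K) ℂ}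
    (hS : (Sc M Z).PosDef) (x : VecIdx r M → ℝ) :
    IsRestrictedMLE Z (thetaS0 t M Z) x ↔ x = matEnc (restrictedB t r M Z) := by
  obtain ⟨c, hc, hf⟩ := f1_restricted (r := r) hJ hK hS
  have hG := gram_posDef (R0hat_posDef (t := t) hK hS) (Er_gram hJ)
  unfold IsRestrictedMLE
  simp only [hf, mul_le_mul_iff_right₀ hc, Real.exp_le_exp, neg_le_neg_iff]
  constructor
  · intro h
    by_contra hne
    have h1 := h (matEnc (restrictedB t r M Z))
    have h2 : matOf x - restrictedB t r M Z ≠ 0 := by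
      rw [sub_ne_zero]
      intro h3
      exact hne (by rw [← h3, matEnc_matOf])
    have h3 := trace_re_conjTranspose_mul_mul_pos hG h2
    rw [matOf_matEnc, sub_self] at h1
    simp only [conjTranspose_zero, Matrix.zero_mul, trace_zero, Complex.zero_re] at h1
    linarith
  · rintro rfl y
    rw [matOf_matEnc, sub_self]
    simp only [conjTranspose_zero, Matrix.zero_mul, trace_zero, Complex.zero_re]
    exact (Complex.nonneg_iff.1
      (hG.posSemidef.conjTranspose_mul_mul_same (matOf y - restrictedB t r M Z)).trace_nonneg).1

theorem thetaR01_eq (hJ : t + r ≤ N) (hK : M + N ≤ K) {Z : Matrix (Fin N) (Fin K) ℂ}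
    (hS : (Sc M Z).PosDef) : thetaR01 t r M Z = matEnc (restrictedB t r M Z) :=
  (isRestrictedMLE_iff hJ hK hS _).1
    (Classical.epsilon_spec ⟨_, (isRestrictedMLE_iff hJ hK hS _).2 rfl⟩)

/-! ### The Gaussian law -/

theorem isAddHaarMeasure_volume_data (N K : ℕ) :
    (volume : Measure (Fin N → Fin K → ℂ)).IsAddHaarMeasure := by
  have : (volume : Measure (Fin K → ℂ)).IsAddHaarMeasure := inferInstance
  exact Measure.pi.isAddHaarMeasure _

/-- The law of a complex Gaussian matrix with independent columns. -/
noncomputable def gaussLaw (μ : Matrix (Fin N) (Fin K) ℂ) (R : Matrix (Fin N) (Fin N) ℂ) :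
    Measure (Fin N → Fin K → ℂ) :=
  volume.withDensity fun Z => ENNReal.ofReal (gaussDensity (Matrix.of Z) μ R)

theorem continuous_gaussDensity (μ : Matrix (Fin N) (Fin K) ℂ) (R : Matrix (Fin N) (Fin N) ℂ) :
    Continuous fun Z : Fin N → Fin K → ℂ => gaussDensity (Matrix.of Z) μ R := by
  have h : Continuous fun Z : Fin N → Fin K → ℂ => (Matrix.of Z - μ : Matrix _ _ ℂ) :=
    (show Continuous fun Z : Fin N → Fin K → ℂ => (Matrix.of Z : Matrix _ _ ℂ) from
      continuous_id).sub continuous_const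
  unfold gaussDensity
  refine continuous_const.mul (Real.continuous_exp.comp (Complex.continuous_re.comp ?_).neg)
  exact ((continuous_const.matrix_mul h).matrix_mul h.matrix_conjTranspose).matrix_trace

theorem det_re_pos {R : Matrix (Fin N) (Fin N) ℂ} (hR : R.PosDef) : 0 < R.det.re :=
  (Complex.pos_iff.1 hR.det_pos).1

theorem gaussDensity_pos (Z μ : Matrix (Fin N) (Fin K) ℂ) {R : Matrix (Fin N) (Fin N) ℂ}
    (hR : R.PosDef) : 0 < gaussDensity Z μ R := by
  have := det_re_pos hR
  unfold gaussDensity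
  positivity

/-- Left multiplication by a matrix on data, as a complex linear map. -/
def leftMul (K : ℕ) (T : Matrix (Fin N) (Fin N) ℂ) :
    (Fin N → Fin K → ℂ) →ₗ[ℂ] (Fin N → Fin K → ℂ) where
  toFun Z := fun i k => (T * Matrix.of Z) i k
  map_add' Z Z' := by
    ext i k
    change (T * (Matrix.of Z + Matrix.of Z')) i k = _
    rw [Matrix.mul_add]; rfl
  map_smul' c Z := by
    ext i k
    change (T * (c • Matrix.of Z)) i k = _
    rw [Matrix.mul_smul]; rfl

theorem det_leftMul (T : Matrix (Fin N) (Fin N) ℂ) :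
    LinearMap.det (leftMul K T) = T.det ^ K := by
  -- After a transposition of the data, left multiplication is a direct sum of `K` copies of `T`,
  -- one for each column.
  let e : (Fin K → Fin N → ℂ) ≃ₗ[ℂ] (Fin N → Fin K → ℂ) :=
    { toFun := fun Z i k => Z k i
      invFun := fun Z k i => Z i k
      map_add' := fun _ _ => rfl
      map_smul' := fun _ _ => rfl
      left_inv := fun _ => rfl
      right_inv := fun _ => rfl }
  have h1 : leftMul K T = e.toLinearMap ∘ₗ
      (LinearMap.pi fun k : Fin K => (Matrix.toLin' T) ∘ₗ LinearMap.proj k) ∘ₗ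
        e.symm.toLinearMap := by
    ext Z i k
    simp [leftMul, e, Matrix.mulVec, dotProduct, Matrix.mul_apply]
  rw [h1, LinearMap.det_conj, LinearMap.det_pi]
  simp

theorem det_leftMul_real (T : Matrix (Fin N) (Fin N) ℂ) :
    LinearMap.det ((leftMul K T).restrictScalars ℝ) = Complex.normSq T.det ^ K := by
  rw [LinearMap.det_restrictScalars, det_leftMul, Algebra.norm_complex_eq]
  simp

/-- The affine action on data. -/
def affineMap (T : Matrix (Fin N) (Fin N) ℂ) (μ : Matrix (Fin N) (Fin K) ℂ)
    (Z : Fin N → Fin K → ℂ) : Fin N → Fin K → ℂ :=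
  leftMul K T Z + fun i k => μ i k

theorem of_affineMap (T : Matrix (Fin N) (Fin N) ℂ) (μ : Matrix (Fin N) (Fin K) ℂ)
    (Z : Fin N → Fin K → ℂ) : Matrix.of (affineMap T μ Z) = T * Matrix.of Z + μ := rfl

theorem continuous_affineMap (T : Matrix (Fin N) (Fin N) ℂ) (μ : Matrix (Fin N) (Fin K) ℂ) :
    Continuous (affineMap T μ) :=
  (LinearMap.continuous_of_finiteDimensional (leftMul K T)).add continuous_const

theorem map_affineMap_volume {T : Matrix (Fin N) (Fin N) ℂ} (hT : T.det ≠ 0)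
    (μ : Matrix (Fin N) (Fin K) ℂ) :
    (volume : Measure (Fin N → Fin K → ℂ)).map (affineMap T μ) =
      ENNReal.ofReal ((Complex.normSq T.det ^ K)⁻¹) • volume := by
  have := isAddHaarMeasure_volume_data N K
  have h0 : LinearMap.det ((leftMul K T).restrictScalars ℝ) ≠ 0 := by
    rw [det_leftMul_real]
    exact pow_ne_zero _ (by simpa using hT)
  have hL : Measurable (leftMul K T) :=
    (LinearMap.continuous_of_finiteDimensional (leftMul K T)).measurable
  have h1 := Measure.map_linearMap_addHaar_eq_smul_addHaar
    (volume : Measure (Fin N → Fin K → ℂ)) h0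
  rw [det_leftMul_real, abs_of_nonneg (by have := Complex.normSq_nonneg T.det; positivity)] at h1
  have h2 : affineMap T μ = (fun Z => Z + fun i k => μ i k) ∘ (leftMul K T) := rfl
  rw [h2, ← Measure.map_map (measurable_add_const _) hL]
  have h3 : (volume : Measure (Fin N → Fin K → ℂ)).map (leftMul K T) =
      ENNReal.ofReal ((Complex.normSq T.det ^ K)⁻¹) • volume := h1
  rw [h3, Measure.map_smul, map_add_right_eq_self]

theorem gaussDensity_affineMap {T : Matrix (Fin N) (Fin N) ℂ} (hT : IsUnit T.det)
    (μ Z : Matrix (Fin N) (Fin K) ℂ) :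
    gaussDensity (T * Z + μ) μ (T * Tᴴ) =
      (Complex.normSq T.det ^ K)⁻¹ * gaussDensity Z 0 1 := by
  have h1 : (T * Tᴴ)⁻¹ * (T * Z + μ - μ) * (T * Z + μ - μ)ᴴ = (Tᴴ)⁻¹ * (Z * Zᴴ * Tᴴ) := by
    rw [add_sub_cancel_right, Matrix.mul_inv_rev, conjTranspose_mul, Matrix.mul_assoc (Tᴴ)⁻¹,
      nonsing_inv_mul_cancel_left _ _ hT]
    simp only [Matrix.mul_assoc]
  have hTh : IsUnit (Tᴴ).det := by simpa [det_conjTranspose] using hT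
  have h2 : ((Tᴴ)⁻¹ * (Z * Zᴴ * Tᴴ)).trace = (Z * Zᴴ).trace := by
    rw [trace_mul_comm, Matrix.mul_assoc, mul_nonsing_inv _ hTh, Matrix.mul_one]
  have h3 : (T * Tᴴ).det.re = Complex.normSq T.det := by
    rw [det_mul, det_conjTranspose, Complex.star_def, Complex.mul_conj]
    simp
  rw [gaussDensity, gaussDensity, h1, h2, h3]
  simp
  ring

/-- The Jacobian `|det T|^{2K}` is exactly the change in the normalizing constant. Total mass,
integrability and the false alarm probability are all reduced to the standard law in this way. -/
theorem gaussLaw_eq_map {T : Matrix (Fin N) (Fin N) ℂ} (hT : IsUnit T.det)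
    (μ : Matrix (Fin N) (Fin K) ℂ) :
    gaussLaw μ (T * Tᴴ) = (gaussLaw (K := K) 0 1).map (affineMap T μ) := by
  have hm := (continuous_affineMap T μ).measurable
  have hn : 0 < Complex.normSq T.det ^ K := by
    have := Complex.normSq_pos.2 hT.ne_zero; positivity
  ext s hs
  have hv : (volume : Measure (Fin N → Fin K → ℂ)) =
      ENNReal.ofReal (Complex.normSq T.det ^ K) • volume.map (affineMap T μ) := by
    rw [map_affineMap_volume hT.ne_zero, smul_smul, ← ENNReal.ofReal_mul hn.le,
      mul_inv_cancel₀ hn.ne', ENNReal.ofReal_one, one_smul]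
  have hd (ν : Matrix (Fin N) (Fin K) ℂ) (R : Matrix (Fin N) (Fin N) ℂ) :
      Measurable fun Z : Fin N → Fin K → ℂ => ENNReal.ofReal (gaussDensity (Matrix.of Z) ν R) :=
    (continuous_gaussDensity ν R).measurable.ennreal_ofReal
  rw [Measure.map_apply hm hs, gaussLaw, gaussLaw, withDensity_apply _ hs,
    withDensity_apply _ (hm hs), hv, Measure.restrict_smul, lintegral_smul_measure,
    setLIntegral_map hs (hd _ _) hm, ← hv, smul_eq_mul,
    ← lintegral_const_mul' _ _ ENNReal.ofReal_ne_top]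
  refine lintegral_congr fun Z => ?_
  rw [of_affineMap, gaussDensity_affineMap hT, ← ENNReal.ofReal_mul hn.le, ← mul_assoc,
    mul_inv_cancel₀ hn.ne', one_mul]

theorem exists_mul_conjTranspose {R : Matrix (Fin N) (Fin N) ℂ} (hR : R.PosDef) :
    ∃ T : Matrix (Fin N) (Fin N) ℂ, IsUnit T.det ∧ R = T * Tᴴ := by
  obtain ⟨L, hL, h⟩ := exists_isUnit_conjTranspose_mul_self hR
  refine ⟨Lᴴ, ?_, by rwa [conjTranspose_conjTranspose]⟩
  simpa [det_conjTranspose] using (Matrix.isUnit_iff_isUnit_det _).1 hL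

theorem gaussDensity_std (Z : Fin N → Fin K → ℂ) :
    gaussDensity (Matrix.of Z) 0 1 = ∏ i, ∏ k, (Real.pi⁻¹ * Real.exp (-‖Z i k‖ ^ 2)) := by
  have h1 : (Matrix.trace ((1 : Matrix (Fin N) (Fin N) ℂ)⁻¹ * (Matrix.of Z - 0) *
      (Matrix.of Z - 0)ᴴ)).re = ∑ i, ∑ k, ‖Z i k‖ ^ 2 := by
    simp only [inv_one, sub_zero, Matrix.one_mul, Matrix.trace, Matrix.diag, Matrix.mul_apply,
      conjTranspose_apply, of_apply, Complex.star_def, Complex.mul_conj, Complex.re_sum,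
      Complex.ofReal_re, Complex.normSq_eq_norm_sq]
  rw [gaussDensity, h1]
  simp only [Finset.prod_mul_distrib, ← Real.exp_sum, Finset.sum_neg_distrib, Finset.prod_const,
    Finset.card_univ, Fintype.card_fin, ← pow_mul]
  simp [mul_comm]

theorem integral_exp_neg_sq (b : ℝ) (hb : 0 < b) :
    Integrable (fun z : ℂ => Real.exp (-b * ‖z‖ ^ 2)) ∧
    ∫ z : ℂ, Real.exp (-b * ‖z‖ ^ 2) = Real.pi / b := by
  have h := GaussianFourier.integral_rexp_neg_mul_sq_norm (V := ℂ) hb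
  have h2 : ∫ z : ℂ, Real.exp (-b * ‖z‖ ^ 2) = Real.pi / b := by
    rw [h, Complex.finrank_real_complex]; norm_num
  refine ⟨?_, h2⟩
  -- The integral of a non-integrable function is 0 by convention, which contradicts the positive
  -- value just found.
  by_contra hn
  rw [integral_undef hn] at h2
  have : 0 < Real.pi / b := by positivity
  exact this.ne h2

theorem integrable_prod_exp (c b : ℝ) (hb : 0 < b) :
    Integrable fun Z : Fin N → Fin K → ℂ => ∏ i, ∏ k, (c * Real.exp (-b * ‖Z i k‖ ^ 2)) := by
  have h1 : Integrable fun z : ℂ => c * Real.exp (-b * ‖z‖ ^ 2) :=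
    (integral_exp_neg_sq b hb).1.const_mul c
  have h2 : Integrable fun z : Fin K → ℂ => ∏ k, (c * Real.exp (-b * ‖z k‖ ^ 2)) :=
    Integrable.fintype_prod (f := fun _ z => c * Real.exp (-b * ‖z‖ ^ 2)) fun _ => h1
  exact Integrable.fintype_prod
    (f := fun (_ : Fin N) (z : Fin K → ℂ) => ∏ k, (c * Real.exp (-b * ‖z k‖ ^ 2))) fun _ => h2

theorem isProbabilityMeasure_gaussLaw_std :
    IsProbabilityMeasure (gaussLaw (N := N) (K := K) 0 1) := by
  have hint : Integrable fun Z : Fin N → Fin K → ℂ => gaussDensity (Matrix.of Z) 0 1 := by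
    simp only [gaussDensity_std]
    simpa using integrable_prod_exp (N := N) (K := K) Real.pi⁻¹ 1 one_pos
  have h1 : ∫ z : ℂ, Real.pi⁻¹ * Real.exp (-‖z‖ ^ 2) = 1 := by
    have := (integral_exp_neg_sq 1 one_pos).2
    simp only [neg_mul, one_mul, div_one] at this
    rw [integral_const_mul, this, inv_mul_cancel₀ Real.pi_ne_zero]
  have h2 : ∫ Z : Fin N → Fin K → ℂ, gaussDensity (Matrix.of Z) 0 1 = 1 := by
    simp only [gaussDensity_std]
    have e1 := integral_fintype_prod_eq_prod (𝕜 := ℝ) (μ := fun _ : Fin N => volume)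
      (fun (_ : Fin N) (z : Fin K → ℂ) => ∏ k, (Real.pi⁻¹ * Real.exp (-‖z k‖ ^ 2)))
    have e2 := integral_fintype_prod_eq_prod (𝕜 := ℝ) (μ := fun _ : Fin K => volume)
      (fun (_ : Fin K) (z : ℂ) => (Real.pi⁻¹ * Real.exp (-‖z‖ ^ 2)))
    refine e1.trans ?_
    refine Finset.prod_eq_one fun _ _ => e2.trans ?_
    exact Finset.prod_eq_one fun _ _ => h1
  refine ⟨?_⟩
  rw [gaussLaw, withDensity_apply _ MeasurableSet.univ, setLIntegral_univ,
    ← ofReal_integral_eq_lintegral_ofReal hint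
      (Filter.Eventually.of_forall fun Z => (gaussDensity_pos _ _ PosDef.one).le), h2,
    ENNReal.ofReal_one]

theorem isProbabilityMeasure_gaussLaw (μ : Matrix (Fin N) (Fin K) ℂ)
    {R : Matrix (Fin N) (Fin N) ℂ} (hR : R.PosDef) : IsProbabilityMeasure (gaussLaw μ R) := by
  obtain ⟨T, hT, rfl⟩ := exists_mul_conjTranspose hR
  rw [gaussLaw_eq_map hT]
  have := isProbabilityMeasure_gaussLaw_std (N := N) (K := K)
  exact Measure.isProbabilityMeasure_map (continuous_affineMap T μ).measurable.aemeasurable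

theorem integrable_gaussLaw_iff {μ : Matrix (Fin N) (Fin K) ℂ} {R : Matrix (Fin N) (Fin N) ℂ}
    (hR : R.PosDef) {φ : (Fin N → Fin K → ℂ) → ℝ} :
    Integrable φ (gaussLaw μ R) ↔
      Integrable fun Z => φ Z * gaussDensity (Matrix.of Z) μ R := by
  rw [gaussLaw, integrable_withDensity_iff_integrable_smul'
    (continuous_gaussDensity μ R).measurable.ennreal_ofReal (by simp)]
  simp only [ENNReal.toReal_ofReal (gaussDensity_pos _ μ hR).le, smul_eq_mul, mul_comm]

theorem integral_gaussLaw {μ : Matrix (Fin N) (Fin K) ℂ} {R : Matrix (Fin N) (Fin N) ℂ}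
    (hR : R.PosDef) (φ : (Fin N → Fin K → ℂ) → ℝ) :
    ∫ Z, φ Z ∂(gaussLaw μ R) = ∫ Z, φ Z * gaussDensity (Matrix.of Z) μ R := by
  rw [gaussLaw, integral_withDensity_eq_integral_toReal_smul
    (continuous_gaussDensity μ R).measurable.ennreal_ofReal (by simp)]
  simp only [ENNReal.toReal_ofReal (gaussDensity_pos _ μ hR).le, smul_eq_mul, mul_comm]

theorem norm_sq_le_sum (Z : Fin N → Fin K → ℂ) : ‖Z‖ ^ 2 ≤ ∑ i, ∑ k, ‖Z i k‖ ^ 2 := by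
  have h0 : 0 ≤ ∑ i, ∑ k, ‖Z i k‖ ^ 2 := by positivity
  have h : ‖Z‖ ≤ Real.sqrt (∑ i, ∑ k, ‖Z i k‖ ^ 2) := by
    refine (pi_norm_le_iff_of_nonneg (Real.sqrt_nonneg _)).2 fun i =>
      (pi_norm_le_iff_of_nonneg (Real.sqrt_nonneg _)).2 fun k => Real.le_sqrt_of_sq_le ?_
    calc ‖Z i k‖ ^ 2 ≤ ∑ k, ‖Z i k‖ ^ 2 :=
          Finset.single_le_sum (f := fun k => ‖Z i k‖ ^ 2) (fun _ _ => by positivity)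
            (Finset.mem_univ k)
      _ ≤ _ := Finset.single_le_sum (f := fun i => ∑ k, ‖Z i k‖ ^ 2)
            (fun _ _ => by positivity) (Finset.mem_univ i)
  calc ‖Z‖ ^ 2 ≤ Real.sqrt (∑ i, ∑ k, ‖Z i k‖ ^ 2) ^ 2 := by gcongr
    _ = _ := Real.sq_sqrt h0

/-- Polynomial growth costs only part of the Gaussian decay. Scores and their products have
temperate growth, so this serves all the integrability claims about them. -/
theorem integrable_std_of_temperate {φ : (Fin N → Fin K → ℂ) → ℝ}
    (hφ : φ.HasTemperateGrowth) : Integrable φ (gaussLaw 0 1) := by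
  rw [integrable_gaussLaw_iff PosDef.one]
  obtain ⟨k, C, hC0, hC⟩ := hφ.norm_iteratedFDeriv_le_uniform 0
  replace hC (Z) : ‖φ Z‖ ≤ C * (1 + ‖Z‖) ^ k := by simpa using hC 0 le_rfl Z
  -- From `(1 + ‖Z‖)^k ≤ e^{k‖Z‖}` and `k‖Z‖ ≤ k²/2 + ‖Z‖²/2`, half of the decay rate is spent and
  -- the factor `e^{k²/2}` appears.
  have hmaj := (integrable_prod_exp (N := N) (K := K) Real.pi⁻¹ (1 / 2) (by norm_num)).const_mul
    (C * Real.exp (k ^ 2 / 2))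
  refine hmaj.mono' (hφ.1.continuous.mul (continuous_gaussDensity 0 1)).aestronglyMeasurable
    (Filter.Eventually.of_forall fun Z => ?_)
  have hprod (b : ℝ) : ∏ i, ∏ k, (Real.pi⁻¹ * Real.exp (-b * ‖Z i k‖ ^ 2)) =
      (∏ _i : Fin N, ∏ _k : Fin K, Real.pi⁻¹) * Real.exp (-b * ∑ i, ∑ k, ‖Z i k‖ ^ 2) := by
    simp only [Finset.prod_mul_distrib, ← Real.exp_sum, ← Finset.mul_sum]
  have hd : gaussDensity (Matrix.of Z) 0 1 =
      (∏ _i : Fin N, ∏ _k : Fin K, Real.pi⁻¹) * Real.exp (-1 * ∑ i, ∑ k, ‖Z i k‖ ^ 2) := by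
    rw [gaussDensity_std, ← hprod]; simp
  rw [norm_mul, Real.norm_of_nonneg (gaussDensity_pos _ _ PosDef.one).le, hd, hprod]
  have hq := norm_sq_le_sum Z
  set q := ∑ i, ∑ k, ‖Z i k‖ ^ 2
  have hp : 0 < ∏ _i : Fin N, ∏ _k : Fin K, Real.pi⁻¹ := by
    have := Real.pi_pos; positivity
  set P := ∏ _i : Fin N, ∏ _k : Fin K, Real.pi⁻¹
  have h1 : (1 + ‖Z‖) ^ k ≤ Real.exp (k ^ 2 / 2 + q / 2) := by
    calc (1 + ‖Z‖) ^ k ≤ Real.exp ‖Z‖ ^ k := by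
          gcongr; rw [add_comm]; exact Real.add_one_le_exp _
      _ = Real.exp (k * ‖Z‖) := (Real.exp_nat_mul _ _).symm
      _ ≤ _ := Real.exp_le_exp.2 (by nlinarith [sq_nonneg ((k : ℝ) - ‖Z‖)])
  calc ‖φ Z‖ * (P * Real.exp (-1 * q))
      ≤ C * Real.exp (k ^ 2 / 2 + q / 2) * (P * Real.exp (-1 * q)) := by
        gcongr
        exact (hC Z).trans (by gcongr)
    _ = C * Real.exp (k ^ 2 / 2) * (P * (Real.exp (q / 2) * Real.exp (-1 * q))) := by
        rw [Real.exp_add]; ring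
    _ = _ := by rw [← Real.exp_add]; ring_nf

theorem integrable_of_temperate {μ : Matrix (Fin N) (Fin K) ℂ} {R : Matrix (Fin N) (Fin N) ℂ}
    (hR : R.PosDef) {φ : (Fin N → Fin K → ℂ) → ℝ} (hφ : φ.HasTemperateGrowth) :
    Integrable φ (gaussLaw μ R) := by
  obtain ⟨T, hT, rfl⟩ := exists_mul_conjTranspose hR
  rw [gaussLaw_eq_map hT, integrable_map_measure hφ.1.continuous.aestronglyMeasurable
    (continuous_affineMap T μ).measurable.aemeasurable]
  refine integrable_std_of_temperate (hφ.comp ?_)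
  have h : (affineMap T μ).HasTemperateGrowth :=
    (LinearMap.toContinuousLinearMap
      ((leftMul K T).restrictScalars ℝ)).hasTemperateGrowth.add (.const _)
  exact h

/-! ### Scores -/

/-- Derivative of the log-likelihood in the direction `D` of the mean, at residual `W`. -/
noncomputable def linScore (R : Matrix (Fin N) (Fin N) ℂ) (D W : Matrix (Fin N) (Fin K) ℂ) : ℝ :=
  2 * (Matrix.trace (R⁻¹ * D * Wᴴ)).re

/-- Quadratic part of the derivative of the log-likelihood in the direction `H` of the
covariance, at residual `W`. -/
noncomputable def quadScore (R H : Matrix (Fin N) (Fin N) ℂ) (W : Matrix (Fin N) (Fin K) ℂ) : ℝ :=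
  (Matrix.trace (R⁻¹ * H * R⁻¹ * W * Wᴴ)).re

/-- Derivative of the log-likelihood in the direction `D` of the mean and `H` of the covariance,
at residual `W`. -/
noncomputable def fullScore (R : Matrix (Fin N) (Fin N) ℂ) (D : Matrix (Fin N) (Fin K) ℂ)
    (H : Matrix (Fin N) (Fin N) ℂ) (W : Matrix (Fin N) (Fin K) ℂ) : ℝ :=
  linScore R D W + quadScore R H W - K * (Matrix.trace (R⁻¹ * H)).re

theorem trace_quadratic_expand {M : Matrix (Fin N) (Fin N) ℂ} (hM : M.IsHermitian)
    (W D : Matrix (Fin N) (Fin K) ℂ) (s : ℝ) :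
    (Matrix.trace (M * (W + s • D) * (W + s • D)ᴴ)).re = (Matrix.trace (M * W * Wᴴ)).re +
      s * (2 * (Matrix.trace (M * D * Wᴴ)).re) + s ^ 2 * (Matrix.trace (M * D * Dᴴ)).re := by
  have h1 : (Matrix.trace (M * W * Dᴴ)).re = (Matrix.trace (M * D * Wᴴ)).re := by
    rw [← trace_conj_eq]
    simp only [conjTranspose_mul, conjTranspose_conjTranspose, hM.eq]
    rw [← Matrix.mul_assoc, trace_mul_comm, Matrix.mul_assoc]
  simp only [conjTranspose_add, conjTranspose_smul, star_trivial, Matrix.mul_add, Matrix.add_mul,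
    Matrix.mul_smul, Matrix.smul_mul, trace_add, trace_smul, Complex.add_re, Complex.smul_re,
    smul_eq_mul, h1]
  ring

theorem hasDerivAt_quadratic (a b c : ℝ) :
    HasDerivAt (fun s : ℝ => a + s * b + s ^ 2 * c) b 0 := by
  have h := (((hasDerivAt_id' (0 : ℝ)).mul_const b).const_add a).fun_add
    (((hasDerivAt_id' (0 : ℝ)).fun_pow 2).mul_const c)
  exact h.congr_deriv (by simp)

theorem isHermitian_inv_mul_mul_inv {R H : Matrix (Fin N) (Fin N) ℂ} (hR : R.IsHermitian)
    (hH : H.IsHermitian) : (R⁻¹ * H * R⁻¹).IsHermitian := by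
  rw [Matrix.IsHermitian, conjTranspose_mul, conjTranspose_mul, hR.inv.eq, hH.eq,
    Matrix.mul_assoc]

theorem hasLineDerivAt_gaussDensity {R : Matrix (Fin N) (Fin N) ℂ} (hR : R.PosDef)
    (μ D : Matrix (Fin N) (Fin K) ℂ) (Z : Fin N → Fin K → ℂ) :
    HasLineDerivAt ℝ (fun Z => gaussDensity (Matrix.of Z) μ R)
      (-(linScore R D (Matrix.of Z - μ)) * gaussDensity (Matrix.of Z) μ R) Z
      (fun i k => D i k) := by
  unfold HasLineDerivAt
  have h1 (s : ℝ) : (Matrix.of (Z + s • fun i k => D i k) : Matrix _ _ ℂ) - μ =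
      (Matrix.of Z - μ) + s • D := by
    change (Matrix.of Z + s • D) - μ = _
    abel
  have h0 (s : ℝ) : gaussDensity (Matrix.of (Z + s • fun i k => D i k)) μ R =
      (Real.pi ^ (N * K))⁻¹ * (R.det.re ^ K)⁻¹ * Real.exp (-(
        (Matrix.trace (R⁻¹ * (Matrix.of Z - μ) * (Matrix.of Z - μ)ᴴ)).re +
        s * (2 * (Matrix.trace (R⁻¹ * D * (Matrix.of Z - μ)ᴴ)).re) +
        s ^ 2 * (Matrix.trace (R⁻¹ * D * Dᴴ)).re)) := by
    rw [gaussDensity, h1, trace_quadratic_expand hR.inv.isHermitian]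
  refine HasDerivAt.congr_of_eventuallyEq ?_ (Filter.Eventually.of_forall h0)
  have h2 := ((hasDerivAt_quadratic (Matrix.trace (R⁻¹ * (Matrix.of Z - μ) *
    (Matrix.of Z - μ)ᴴ)).re (2 * (Matrix.trace (R⁻¹ * D * (Matrix.of Z - μ)ᴴ)).re)
      (Matrix.trace (R⁻¹ * D * Dᴴ)).re).fun_neg.exp).const_mul
      ((Real.pi ^ (N * K))⁻¹ * (R.det.re ^ K)⁻¹)
  refine h2.congr_deriv ?_
  simp only [linScore, gaussDensity, zero_mul, add_zero, ne_eq, OfNat.ofNat_ne_zero,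
    not_false_eq_true, zero_pow]
  ring

theorem hasLineDerivAt_linScore (R : Matrix (Fin N) (Fin N) ℂ)
    (μ D D' : Matrix (Fin N) (Fin K) ℂ) (Z : Fin N → Fin K → ℂ) :
    HasLineDerivAt ℝ (fun Z => linScore R D (Matrix.of Z - μ)) (linScore R D D') Z
      (fun i k => D' i k) := by
  unfold HasLineDerivAt
  have h1 (s : ℝ) : (Matrix.of (Z + s • fun i k => D' i k) : Matrix _ _ ℂ) - μ =
      (Matrix.of Z - μ) + s • D' := by
    change (Matrix.of Z + s • D') - μ = _
    abel
  have h2 (s : ℝ) : linScore R D ((Matrix.of Z - μ) + s • D') =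
      linScore R D (Matrix.of Z - μ) + s * linScore R D D' + s ^ 2 * 0 := by
    simp only [linScore, conjTranspose_add, conjTranspose_smul, star_trivial, Matrix.mul_add,
      Matrix.mul_smul, trace_add, trace_smul, Complex.add_re, Complex.smul_re, smul_eq_mul]
    ring
  refine HasDerivAt.congr_of_eventuallyEq ?_
    (Filter.Eventually.of_forall fun s => (congrArg (linScore R D) (h1 s)).trans (h2 s))
  exact hasDerivAt_quadratic _ _ _

/-- The derivative is written as a linear score along `H R⁻¹ D` so that its expectation is seen to
vanish. -/
theorem hasLineDerivAt_quadScore {R H : Matrix (Fin N) (Fin N) ℂ} (hR : R.IsHermitian)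
    (hH : H.IsHermitian) (μ D : Matrix (Fin N) (Fin K) ℂ) (Z : Fin N → Fin K → ℂ) :
    HasLineDerivAt ℝ (fun Z => quadScore R H (Matrix.of Z - μ))
      (linScore R (H * R⁻¹ * D) (Matrix.of Z - μ)) Z (fun i k => D i k) := by
  unfold HasLineDerivAt
  have h1 (s : ℝ) : (Matrix.of (Z + s • fun i k => D i k) : Matrix _ _ ℂ) - μ =
      (Matrix.of Z - μ) + s • D := by
    change (Matrix.of Z + s • D) - μ = _
    abel
  refine HasDerivAt.congr_of_eventuallyEq ?_
    (Filter.Eventually.of_forall fun s => (congrArg (quadScore R H) (h1 s)).trans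
      (trace_quadratic_expand (isHermitian_inv_mul_mul_inv hR hH) _ _ _))
  refine (hasDerivAt_quadratic _ _ _).congr_deriv ?_
  simp only [linScore, Matrix.mul_assoc]

/-- Matrix-valued functions whose entries have temperate growth. -/
def MatTemperate {l m : Type*} (F : (Fin N → Fin K → ℂ) → Matrix l m ℂ) : Prop :=
  ∀ i j, (fun Z => F Z i j).HasTemperateGrowth

theorem MatTemperate.mul {l m n : Type*} [Fintype m]
    {F : (Fin N → Fin K → ℂ) → Matrix l m ℂ} {G : (Fin N → Fin K → ℂ) → Matrix m n ℂ}
    (hF : MatTemperate F) (hG : MatTemperate G) : MatTemperate fun Z => F Z * G Z := by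
  intro i j
  simp only [Matrix.mul_apply]
  exact Function.HasTemperateGrowth.sum fun k _ => (hF i k).mul (hG k j)

theorem MatTemperate.const {l m : Type*} (A : Matrix l m ℂ) :
    MatTemperate fun _ : Fin N → Fin K → ℂ => A := fun _ _ => .const _

theorem MatTemperate.conjTranspose {l m : Type*}
    {F : (Fin N → Fin K → ℂ) → Matrix l m ℂ} (hF : MatTemperate F) :
    MatTemperate fun Z => (F Z)ᴴ := fun i j =>
  Complex.conjCLE.toContinuousLinearMap.hasTemperateGrowth.comp (hF j i)

theorem MatTemperate.sub_const (μ : Matrix (Fin N) (Fin K) ℂ) :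
    MatTemperate fun Z : Fin N → Fin K → ℂ => (Matrix.of Z - μ : Matrix _ _ ℂ) := fun i k =>
  (((ContinuousLinearMap.proj (R := ℝ) (φ := fun _ : Fin K => ℂ) k).comp
    (ContinuousLinearMap.proj (R := ℝ) (φ := fun _ : Fin N => Fin K → ℂ) i)).hasTemperateGrowth).sub
      (.const _)

theorem MatTemperate.trace_re {l : Type*} [Fintype l]
    {F : (Fin N → Fin K → ℂ) → Matrix l l ℂ} (hF : MatTemperate F) :
    (fun Z => (Matrix.trace (F Z)).re).HasTemperateGrowth := by
  have : (fun Z => Matrix.trace (F Z)).HasTemperateGrowth := by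
    simp only [Matrix.trace, Matrix.diag]
    exact Function.HasTemperateGrowth.sum fun k _ => hF k k
  exact Complex.reCLM.hasTemperateGrowth.comp this

theorem temperate_linScore (R : Matrix (Fin N) (Fin N) ℂ) (μ D : Matrix (Fin N) (Fin K) ℂ) :
    (fun Z : Fin N → Fin K → ℂ => linScore R D (Matrix.of Z - μ)).HasTemperateGrowth :=
  (Function.HasTemperateGrowth.const 2).mul
    ((MatTemperate.const (R⁻¹ * D)).mul (MatTemperate.sub_const μ).conjTranspose).trace_re

theorem temperate_fullScore (R : Matrix (Fin N) (Fin N) ℂ) (μ D : Matrix (Fin N) (Fin K) ℂ)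
    (H : Matrix (Fin N) (Fin N) ℂ) :
    (fun Z : Fin N → Fin K → ℂ => fullScore R D H (Matrix.of Z - μ)).HasTemperateGrowth :=
  ((temperate_linScore R μ D).add
    (((MatTemperate.const (R⁻¹ * H * R⁻¹)).mul (MatTemperate.sub_const μ)).mul
      (MatTemperate.sub_const μ).conjTranspose).trace_re).sub (.const _)

/-- Stein's identity for complex Gaussian matrices. -/
theorem integral_mul_linScore {R : Matrix (Fin N) (Fin N) ℂ} (hR : R.PosDef)
    (μ D : Matrix (Fin N) (Fin K) ℂ) {φ φ' : (Fin N → Fin K → ℂ) → ℝ}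
    (hφ : φ.HasTemperateGrowth) (hφ' : φ'.HasTemperateGrowth)
    (hd : ∀ Z, HasLineDerivAt ℝ φ (φ' Z) Z (fun i k => D i k)) :
    ∫ Z, φ Z * linScore R D (Matrix.of Z - μ) ∂(gaussLaw μ R) = ∫ Z, φ' Z ∂(gaussLaw μ R) := by
  have := isAddHaarMeasure_volume_data N K
  have h1 := (integrable_gaussLaw_iff hR).1 (integrable_of_temperate (μ := μ) hR hφ')
  have h2 := (integrable_gaussLaw_iff hR).1 (integrable_of_temperate (μ := μ) hR hφ)
  have h3 := (integrable_gaussLaw_iff hR).1 (integrable_of_temperate (μ := μ) hR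
    (hφ.mul (temperate_linScore R μ D)))
  have h3' : Integrable fun Z : Fin N → Fin K → ℂ =>
      φ Z * (-(linScore R D (Matrix.of Z - μ)) * gaussDensity (Matrix.of Z) μ R) := by
    refine h3.neg.congr (Filter.Eventually.of_forall fun Z => ?_)
    simp only [Pi.neg_apply, Pi.mul_apply]
    ring
  -- Integration by parts along `D`: the derivative of the density is `-linScore` times the density,
  -- and the three integrability facts exclude a boundary term.
  have key := integral_bilinear_hasLineDerivAt_right_eq_neg_left_of_integrable
    (μ := (volume : Measure (Fin N → Fin K → ℂ))) (B := ContinuousLinearMap.mul ℝ ℝ)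
    (f := φ) (f' := φ') (g := fun Z => gaussDensity (Matrix.of Z) μ R)
    (g' := fun Z => -(linScore R D (Matrix.of Z - μ)) * gaussDensity (Matrix.of Z) μ R)
    (v := fun i k => D i k) h1 h3' h2 (fun Z _ => hd Z)
    (fun Z _ => hasLineDerivAt_gaussDensity hR μ D Z)
  simp only [ContinuousLinearMap.mul_apply'] at key
  rw [integral_gaussLaw hR, integral_gaussLaw hR, ← neg_inj, ← key, ← integral_neg]
  congr 1
  ext Z
  ring

theorem integral_linScore {R : Matrix (Fin N) (Fin N) ℂ} (hR : R.PosDef)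
    (μ D : Matrix (Fin N) (Fin K) ℂ) :
    ∫ Z, linScore R D (Matrix.of Z - μ) ∂(gaussLaw μ R) = 0 := by
  have h := integral_mul_linScore hR μ D (φ := fun _ => 1) (φ' := fun _ => 0) (.const _) (.const _)
    (fun Z => by simpa [HasLineDerivAt] using hasDerivAt_const (0 : ℝ) (1 : ℝ))
  simpa using h

/-- Stein's identity replaces the product by the derivative of the full score along `D'`. The
quadratic part contributes a linear score of mean zero, which is why mean and covariance directions
are orthogonal for the information. -/
theorem integral_fullScore_mul_linScore {R H : Matrix (Fin N) (Fin N) ℂ} (hR : R.PosDef)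
    (hH : H.IsHermitian) (μ D D' : Matrix (Fin N) (Fin K) ℂ) :
    ∫ Z, fullScore R D H (Matrix.of Z - μ) * linScore R D' (Matrix.of Z - μ) ∂(gaussLaw μ R) =
      linScore R D D' := by
  have := isProbabilityMeasure_gaussLaw μ hR
  have h := integral_mul_linScore hR μ D' (temperate_fullScore R μ D H)
    (φ' := fun Z => linScore R D D' + linScore R (H * R⁻¹ * D') (Matrix.of Z - μ))
    ((Function.HasTemperateGrowth.const _).add (temperate_linScore R μ _))
    (fun Z => ((hasLineDerivAt_linScore R μ D D' Z).add
      (hasLineDerivAt_quadScore hR.isHermitian hH μ D' Z)).sub_const _)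
  rw [h, integral_add (integrable_const _) (integrable_of_temperate hR (temperate_linScore R μ _)),
    integral_linScore hR]
  simp

/-! ### The derivative of the log-likelihood -/

section Deriv

attribute [local instance] Matrix.linftyOpNormedRing Matrix.linftyOpNormedAlgebra

/-- This is the chain rule through the derivative `X ↦ -R⁻¹ X R⁻¹` of inversion. The local norm on
matrices only provides the normed algebra in which this derivative is taken. -/
theorem hasDerivAt_trace_inv_mul {R : Matrix (Fin N) (Fin N) ℂ} (hR : R.PosDef)
    (H V : Matrix (Fin N) (Fin N) ℂ) :
    HasDerivAt (fun s : ℝ => (Matrix.trace ((R + s • H)⁻¹ * V)).re)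
      (-(Matrix.trace (R⁻¹ * H * R⁻¹ * V)).re) 0 := by
  obtain ⟨u, hu⟩ := hR.isUnit
  have h1 : HasDerivAt (fun s : ℝ => R + s • H) H 0 := by
    have h := ((hasDerivAt_id' (0 : ℝ)).smul_const H).const_add R
    rwa [one_smul] at h
  have h2 := hasFDerivAt_ringInverse (𝕜 := ℝ) u
  rw [hu, show R = R + (0 : ℝ) • H by rw [zero_smul, add_zero]] at h2
  have h4 := h2.comp_hasDerivAt (0 : ℝ) h1
  let L : Matrix (Fin N) (Fin N) ℂ →ₗ[ℝ] ℝ :=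
    { toFun := fun X => (Matrix.trace (X * V)).re
      map_add' := fun X Y => by rw [Matrix.add_mul, trace_add, Complex.add_re]
      map_smul' := fun c X => by rw [Matrix.smul_mul, trace_smul, Complex.smul_re]; rfl }
  have h5 := (LinearMap.toContinuousLinearMap L).hasFDerivAt.comp_hasDerivAt (0 : ℝ) h4
  refine (h5.congr_of_eventuallyEq (Filter.Eventually.of_forall fun s => ?_)).congr_deriv ?_
  · simp [L, Matrix.nonsing_inv_eq_ringInverse]
  · have : (↑u⁻¹ : Matrix (Fin N) (Fin N) ℂ) = R⁻¹ := by
      rw [Matrix.coe_units_inv, hu]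
    have hL (X : Matrix (Fin N) (Fin N) ℂ) :
        LinearMap.toContinuousLinearMap L X = (Matrix.trace (X * V)).re := rfl
    refine (hL _).trans ?_
    rw [_root_.neg_apply, ContinuousLinearMap.mulLeftRight_apply, this,
      Matrix.neg_mul, trace_neg, Complex.neg_re]

end Deriv

theorem hasDerivAt_det_re {R : Matrix (Fin N) (Fin N) ℂ} (hR : R.PosDef)
    (H : Matrix (Fin N) (Fin N) ℂ) :
    HasDerivAt (fun s : ℝ => (R + s • H).det.re) (R.det.re * (Matrix.trace (R⁻¹ * H)).re) 0 := by
  have hd := PosDef.isUnit_det hR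
  have h1 (s : ℝ) : (R + s • H).det = R.det * (1 + (s : ℂ) • (R⁻¹ * H)).det := by
    rw [← det_mul, Matrix.mul_add, Matrix.mul_one, Matrix.mul_smul, mul_nonsing_inv_cancel_left _ _ hd]
    rfl
  have h2 : R.det = (R.det.re : ℂ) := Complex.ext rfl (by simp [← (Complex.pos_iff.1 hR.det_pos).2])
  -- `P` is the remainder in `det(1 + s X) = 1 + s Tr X + s² P(s)`, with `X = R⁻¹ H`. It does not
  -- affect the derivative at 0.
  set P := (det (1 + (Polynomial.X : Polynomial ℂ) • (R⁻¹ * H).map Polynomial.C)).divX.divX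
  have h3 : HasDerivAt (fun z : ℂ => 1 + Matrix.trace (R⁻¹ * H) * z + P.eval z * z ^ 2)
      (Matrix.trace (R⁻¹ * H)) ((0 : ℝ) : ℂ) := by
    have := (((hasDerivAt_id' (((0 : ℝ) : ℂ))).const_mul (Matrix.trace (R⁻¹ * H))).const_add
      1).fun_add ((P.hasDerivAt ((0 : ℝ) : ℂ)).fun_mul ((hasDerivAt_id' (((0 : ℝ) : ℂ))).fun_pow 2))
    exact this.congr_deriv (by simp)
  have h4 := (h3.real_of_complex).const_mul R.det.re
  refine h4.congr_of_eventuallyEq (Filter.Eventually.of_forall fun s => ?_)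
  beta_reduce
  rw [h1, h2, Complex.re_ofReal_mul, Matrix.det_one_add_smul]
  rfl

/-- The direction of the mean belonging to a direction of the parameter. -/
noncomputable def meanDir (K : ℕ) {N t r M : ℕ} (v : VecIdx r M ⊕ NuisIdx t M N → ℝ) :
    Matrix (Fin N) (Fin K) ℂ :=
  leftA N t r * thetaBs v * rightC M K

theorem thetaBs_add (u v : VecIdx r M ⊕ NuisIdx t M N → ℝ) :
    thetaBs (u + v) = thetaBs u + thetaBs v := by
  ext (i | i) j <;> simp [thetaBs, nuisB, matOf, Complex.ext_iff]

theorem thetaBs_smul (s : ℝ) (v : VecIdx r M ⊕ NuisIdx t M N → ℝ) :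
    thetaBs (s • v) = s • thetaBs v := by
  ext (i | i) j <;> simp [thetaBs, nuisB, matOf, Complex.ext_iff]

theorem thetaR_add (u v : VecIdx r M ⊕ NuisIdx t M N → ℝ) :
    thetaR (u + v) = thetaR u + thetaR v := by
  ext i j
  simp only [thetaR, nuisR, covOf, of_apply, Pi.add_apply, Matrix.add_apply]
  split_ifs <;> simp [Complex.ext_iff]
  ring

theorem thetaR_smul (s : ℝ) (v : VecIdx r M ⊕ NuisIdx t M N → ℝ) :
    thetaR (s • v) = s • thetaR v := by
  ext i j
  simp only [thetaR, nuisR, covOf, of_apply, Pi.smul_apply, Matrix.smul_apply]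
  split_ifs <;> simp [Complex.ext_iff]

theorem meanDir_add (u v : VecIdx r M ⊕ NuisIdx t M N → ℝ) :
    meanDir K (u + v) = meanDir K u + meanDir K v := by
  simp only [meanDir, thetaBs_add, Matrix.mul_add, Matrix.add_mul]

theorem meanDir_smul (s : ℝ) (v : VecIdx r M ⊕ NuisIdx t M N → ℝ) :
    meanDir K (s • v) = s • meanDir K v := by
  simp only [meanDir, thetaBs_smul, Matrix.mul_smul, Matrix.smul_mul]

theorem thetaR_isHermitian (v : VecIdx r M ⊕ NuisIdx t M N → ℝ) : (thetaR v).IsHermitian :=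
  covOf_isHermitian _

theorem hasLineDerivAt_logLik (Z : Matrix (Fin N) (Fin K) ℂ)
    {θ : VecIdx r M ⊕ NuisIdx t M N → ℝ} (hR : (thetaR θ).PosDef)
    (v : VecIdx r M ⊕ NuisIdx t M N → ℝ) :
    HasLineDerivAt ℝ (logLik Z) (fullScore (thetaR θ) (meanDir K v) (thetaR v)
      (Z - meanDir K θ)) θ v := by
  unfold HasLineDerivAt
  set R := thetaR θ with hRdef
  set H := thetaR v
  set D := meanDir K v with hD
  set W := Z - meanDir K θ with hW
  have hf (s : ℝ) : logLik Z (θ + s • v) = Real.log ((Real.pi ^ (N * K))⁻¹ *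
      ((R + s • H).det.re ^ K)⁻¹ * Real.exp (-((Matrix.trace ((R + s • H)⁻¹ * (W * Wᴴ))).re +
        s * -(Matrix.trace ((R + s • H)⁻¹ * (D * Wᴴ + W * Dᴴ))).re +
        s ^ 2 * (Matrix.trace ((R + s • H)⁻¹ * (D * Dᴴ))).re))) := by
    have e1 : Z - leftA N t r * thetaBs (θ + s • v) * rightC M K = W - s • D := by
      change Z - meanDir K (θ + s • v) = _
      rw [meanDir_add, meanDir_smul, hW, hD]; abel
    rw [logLik, f1, gaussDensity, e1, thetaR_add, thetaR_smul, Matrix.mul_assoc]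
    congr 4
    simp only [conjTranspose_sub, conjTranspose_smul, star_trivial, Matrix.mul_add, Matrix.sub_mul,
      Matrix.mul_sub, Matrix.mul_smul, Matrix.smul_mul, trace_add, trace_sub, trace_smul,
      Complex.add_re, Complex.sub_re, Complex.smul_re, smul_eq_mul]
    ring
  refine HasDerivAt.congr_of_eventuallyEq ?_ (Filter.Eventually.of_forall hf)
  have hdp := det_re_pos hR
  have hdet := hasDerivAt_det_re hR H
  have i0 := hasDerivAt_trace_inv_mul hR H (W * Wᴴ)
  have i1 := hasDerivAt_trace_inv_mul hR H (D * Wᴴ + W * Dᴴ)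
  have i2 := hasDerivAt_trace_inv_mul hR H (D * Dᴴ)
  have hid := hasDerivAt_id' (0 : ℝ)
  have hq := ((i0.fun_add (hid.fun_mul i1.fun_neg)).fun_add
    ((hid.fun_pow 2).fun_mul i2)).fun_neg.exp
  have hp := ((hdet.fun_pow K).fun_inv (by simpa using (pow_pos hdp K).ne')).const_mul
    (Real.pi ^ (N * K))⁻¹
  have hne : (Real.pi ^ (N * K))⁻¹ * ((R + (0 : ℝ) • H).det.re ^ K)⁻¹ *
      Real.exp (-((Matrix.trace ((R + (0 : ℝ) • H)⁻¹ * (W * Wᴴ))).re +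
        0 * -(Matrix.trace ((R + (0 : ℝ) • H)⁻¹ * (D * Wᴴ + W * Dᴴ))).re +
        0 ^ 2 * (Matrix.trace ((R + (0 : ℝ) • H)⁻¹ * (D * Dᴴ))).re)) ≠ 0 := by
    rw [zero_smul, add_zero]
    have := Real.pi_pos
    positivity
  have hl := (hp.fun_mul hq).log hne
  refine hl.congr_deriv ?_
  have e2 : (Matrix.trace (R⁻¹ * (D * Wᴴ + W * Dᴴ))).re = linScore R D W := by
    have h1 : (Matrix.trace (R⁻¹ * (W * Dᴴ))).re = (Matrix.trace (R⁻¹ * (D * Wᴴ))).re := by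
      rw [← trace_conj_eq]
      simp only [conjTranspose_mul, conjTranspose_conjTranspose, hR.inv.isHermitian.eq]
      rw [trace_mul_comm]
    rw [Matrix.mul_add, trace_add, Complex.add_re, h1, linScore, Matrix.mul_assoc]
    ring
  have e3 : (Matrix.trace (R⁻¹ * H * R⁻¹ * (W * Wᴴ))).re = quadScore R H W := by
    rw [quadScore]; simp only [Matrix.mul_assoc]
  simp only [zero_smul, add_zero, e2, e3, fullScore]
  have hpi := Real.pi_pos
  have hx := Real.exp_pos (-(Matrix.trace (R⁻¹ * (W * Wᴴ))).re)
  -- The derivative of a `K`-th power carries the exponent `K - 1`, truncated at `K = 0`.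
  rcases K with _ | K
  · simp
  · simp
    field_simp
    ring

/-! ### Joint differentiability of the log-likelihood -/

theorem differentiableAt_det {E l : Type*} [NormedAddCommGroup E] [NormedSpace ℝ E] [Fintype l]
    [DecidableEq l] {F : E → Matrix l l ℂ} {x : E}
    (hF : ∀ i j, DifferentiableAt ℝ (fun y => F y i j) x) :
    DifferentiableAt ℝ (fun y => (F y).det) x := by
  simp only [Matrix.det_apply]
  refine DifferentiableAt.fun_sum fun σ _ => ?_
  have : DifferentiableAt ℝ (fun y => ∏ i, F y (σ i) i) x := by
    exact (HasFDerivAt.finsetProd (u := Finset.univ) (g := fun i y => F y (σ i) i) fun i _ => (hF (σ i) i).hasFDerivAt).differentiableAt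
  exact this.const_smul _

theorem differentiableAt_inv {E l : Type*} [NormedAddCommGroup E] [NormedSpace ℝ E] [Fintype l]
    [DecidableEq l] {F : E → Matrix l l ℂ} {x : E}
    (hF : ∀ i j, DifferentiableAt ℝ (fun y => F y i j) x) (h0 : (F x).det ≠ 0) (i j : l) :
    DifferentiableAt ℝ (fun y => (F y)⁻¹ i j) x := by
  simp only [Matrix.inv_def, Ring.inverse_eq_inv', Matrix.smul_apply, smul_eq_mul,
    Matrix.adjugate_apply]
  refine ((differentiableAt_det hF).inv h0).mul (differentiableAt_det fun k m => ?_)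
  by_cases h : k = j
  · subst h; simp
  · simpa [Matrix.updateRow_ne h] using hF k m

theorem differentiableAt_mul {E l m n : Type*} [NormedAddCommGroup E] [NormedSpace ℝ E] [Fintype m]
    {F : E → Matrix l m ℂ} {G : E → Matrix m n ℂ} {x : E}
    (hF : ∀ i j, DifferentiableAt ℝ (fun y => F y i j) x)
    (hG : ∀ i j, DifferentiableAt ℝ (fun y => G y i j) x) (i : l) (j : n) :
    DifferentiableAt ℝ (fun y => (F y * G y) i j) x := by
  simp only [Matrix.mul_apply]
  exact DifferentiableAt.fun_sum fun k _ => (hF i k).mul (hG k j)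

theorem differentiable_of_linear {ι : Type*} [Fintype ι] {f : (ι → ℝ) → ℂ}
    (h1 : ∀ u v, f (u + v) = f u + f v) (h2 : ∀ (s : ℝ) u, f (s • u) = s • f u) :
    Differentiable ℝ f :=
  (LinearMap.toContinuousLinearMap
    ({ toFun := f, map_add' := h1, map_smul' := h2 } : (ι → ℝ) →ₗ[ℝ] ℂ)).differentiable

/-- Line derivatives do not give joint differentiability. Here mean and covariance are linear in the
parameter, and determinant and inverse are rational in the entries with a nonzero denominator at
`θ`. -/
theorem differentiableAt_logLik (Z : Matrix (Fin N) (Fin K) ℂ)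
    {θ : VecIdx r M ⊕ NuisIdx t M N → ℝ} (hR : (thetaR θ).PosDef) :
    DifferentiableAt ℝ (logLik Z) θ := by
  have hRd (i j : Fin N) : DifferentiableAt ℝ
      (fun x : VecIdx r M ⊕ NuisIdx t M N → ℝ => thetaR x i j) θ :=
    differentiable_of_linear (fun u v => by rw [thetaR_add]; rfl)
      (fun s u => by rw [thetaR_smul]; rfl) θ
  have hD (i : Fin N) (j : Fin K) : DifferentiableAt ℝ
      (fun x : VecIdx r M ⊕ NuisIdx t M N → ℝ => (Z - meanDir K x) i j) θ :=
    (differentiableAt_const (Z i j)).sub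
      (differentiable_of_linear (f := fun x => meanDir K x i j)
        (fun u v => by rw [meanDir_add]; rfl) (fun s u => by rw [meanDir_smul]; rfl) θ)
  have hDc (i : Fin K) (j : Fin N) : DifferentiableAt ℝ
      (fun x : VecIdx r M ⊕ NuisIdx t M N → ℝ => (Z - meanDir K x)ᴴ i j) θ :=
    Complex.conjCLE.differentiableAt.comp θ (hD j i)
  have hdp := det_re_pos hR
  have hdet : DifferentiableAt ℝ
      (fun x : VecIdx r M ⊕ NuisIdx t M N → ℝ => (thetaR x).det.re) θ :=
    Complex.reCLM.differentiableAt.comp θ (differentiableAt_det hRd)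
  have htr : DifferentiableAt ℝ (fun x : VecIdx r M ⊕ NuisIdx t M N → ℝ =>
      (Matrix.trace ((thetaR x)⁻¹ * (Z - meanDir K x) * (Z - meanDir K x)ᴴ)).re) θ := by
    refine Complex.reCLM.differentiableAt.comp θ ?_
    simp only [Matrix.trace, Matrix.diag]
    exact DifferentiableAt.fun_sum fun i _ => differentiableAt_mul
      (differentiableAt_mul (differentiableAt_inv hRd hR.det_pos.ne') hD) hDc i i
  have h : DifferentiableAt ℝ (fun x : VecIdx r M ⊕ NuisIdx t M N → ℝ =>
      gaussDensity Z (meanDir K x) (thetaR x)) θ := by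
    unfold gaussDensity
    exact (((hdet.fun_pow K).fun_inv (pow_pos hdp K).ne').const_mul _).fun_mul htr.fun_neg.exp
  exact h.log (gaussDensity_pos _ _ hR).ne'

/-! ### The Fisher information matrix -/

theorem score_eq (Z : Matrix (Fin N) (Fin K) ℂ) {θ : VecIdx r M ⊕ NuisIdx t M N → ℝ}
    (hR : (thetaR θ).PosDef) (k : VecIdx r M ⊕ NuisIdx t M N) :
    score Z θ k = fullScore (thetaR θ) (meanDir K (Pi.single k 1)) (thetaR (Pi.single k 1))
      (Z - meanDir K θ) :=
  (hasLineDerivAt_logLik Z hR _).lineDeriv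

/-- The score in a direction of the parameter space is linear in the direction. -/
theorem sum_mul_score (Z : Matrix (Fin N) (Fin K) ℂ) {θ : VecIdx r M ⊕ NuisIdx t M N → ℝ}
    (hR : (thetaR θ).PosDef) (v : VecIdx r M ⊕ NuisIdx t M N → ℝ) :
    ∑ k, v k * score Z θ k = fullScore (thetaR θ) (meanDir K v) (thetaR v) (Z - meanDir K θ) := by
  let f : (VecIdx r M ⊕ NuisIdx t M N → ℝ) →ₗ[ℝ] ℝ :=
    { toFun := fun v => fullScore (thetaR θ) (meanDir K v) (thetaR v) (Z - meanDir K θ)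
      map_add' := fun u v => by
        simp only [fullScore, linScore, quadScore, meanDir_add, thetaR_add, Matrix.mul_add,
          Matrix.add_mul, trace_add, Complex.add_re]
        ring
      map_smul' := fun s v => by
        simp only [fullScore, linScore, quadScore, meanDir_smul, thetaR_smul, Matrix.mul_smul,
          Matrix.smul_mul, trace_smul, Complex.smul_re, smul_eq_mul, RingHom.id_apply]
        ring }
  have h1 : v = ∑ k, v k • (Pi.single k 1 : VecIdx r M ⊕ NuisIdx t M N → ℝ) := pi_eq_sum_univ' v
  change _ = f v
  conv_rhs => rw [h1]
  rw [map_sum]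
  refine Finset.sum_congr rfl fun k _ => ?_
  rw [map_smul, smul_eq_mul, score_eq Z hR]
  rfl

theorem law1_eq (θ : VecIdx r M ⊕ NuisIdx t M N → ℝ) :
    law1 K (thetaBs θ) (thetaR θ) = gaussLaw (meanDir K θ) (thetaR θ) := rfl

theorem temperate_score {θ : VecIdx r M ⊕ NuisIdx t M N → ℝ} (hR : (thetaR θ).PosDef)
    (k : VecIdx r M ⊕ NuisIdx t M N) :
    (fun Z : Fin N → Fin K → ℂ => score (Matrix.of Z) θ k).HasTemperateGrowth := by
  simp only [score_eq _ hR]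
  exact temperate_fullScore _ _ _ _

theorem integrable_score_mul_score {θ : VecIdx r M ⊕ NuisIdx t M N → ℝ} (hR : (thetaR θ).PosDef)
    (k l : VecIdx r M ⊕ NuisIdx t M N) :
    Integrable (fun Z : Fin N → Fin K → ℂ => score (Matrix.of Z) θ k * score (Matrix.of Z) θ l)
      (law1 K (thetaBs θ) (thetaR θ)) :=
  integrable_of_temperate hR ((temperate_score hR k).mul (temperate_score hR l))

theorem fisher_mulVec_eq_integral {θ : VecIdx r M ⊕ NuisIdx t M N → ℝ} (hR : (thetaR θ).PosDef)
    (v : VecIdx r M ⊕ NuisIdx t M N → ℝ) (k : VecIdx r M ⊕ NuisIdx t M N) :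
    (fisher K θ *ᵥ v) k = ∫ Z, score (Matrix.of Z) θ k *
      fullScore (thetaR θ) (meanDir K v) (thetaR v) (Matrix.of Z - meanDir K θ)
        ∂(gaussLaw (meanDir K θ) (thetaR θ)) := by
  simp only [← sum_mul_score _ hR, Finset.mul_sum]
  rw [integral_finsetSum]
  · simp only [Matrix.mulVec, dotProduct, fisher, of_apply]
    refine Finset.sum_congr rfl fun l _ => ?_
    rw [law1_eq, ← integral_mul_const]
    congr 1
    ext Z
    ring
  · intro l _
    exact integrable_of_temperate hR ((temperate_score hR k).mul
      ((Function.HasTemperateGrowth.const (v l)).mul (temperate_score hR l)))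

/-- The Fisher information applied to a direction of the mean. -/
theorem fisher_mulVec_meanDir {θ : VecIdx r M ⊕ NuisIdx t M N → ℝ} (hR : (thetaR θ).PosDef)
    {v : VecIdx r M ⊕ NuisIdx t M N → ℝ} (hv : thetaR v = 0)
    (k : VecIdx r M ⊕ NuisIdx t M N) :
    (fisher K θ *ᵥ v) k = linScore (thetaR θ) (meanDir K (Pi.single k 1)) (meanDir K v) := by
  rw [fisher_mulVec_eq_integral hR, ← integral_fullScore_mul_linScore hR
    (thetaR_isHermitian (Pi.single k 1)) (meanDir K θ)]
  congr 1
  ext Z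
  rw [score_eq _ hR, hv]
  simp [fullScore, quadScore]

/-- The linear part is odd in `W` and the quadratic part even, so each vanishes separately. Testing
the linear part at `W = D` kills `D`; polarizing the quadratic part kills `R⁻¹ H R⁻¹`. -/
theorem fullScore_eq_zero (hK : N ≤ K) {R H : Matrix (Fin N) (Fin N) ℂ} (hR : R.PosDef)
    (hH : H.IsHermitian) {D : Matrix (Fin N) (Fin K) ℂ} (h : ∀ W, fullScore R D H W = 0) :
    D = 0 ∧ H = 0 := by
  have hlin (W : Matrix (Fin N) (Fin K) ℂ) : linScore R D (-W) = -linScore R D W := by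
    simp [linScore]
  have hquad (W : Matrix (Fin N) (Fin K) ℂ) : quadScore R H (-W) = quadScore R H W := by
    simp [quadScore]
  have h0 : K * (Matrix.trace (R⁻¹ * H)).re = 0 := by
    have := h 0
    simpa [fullScore, linScore, quadScore] using this
  have h1 (W : Matrix (Fin N) (Fin K) ℂ) : linScore R D W = 0 ∧ quadScore R H W = 0 := by
    have e1 := h W
    have e2 := h (-W)
    rw [fullScore, h0] at e1 e2
    rw [hlin, hquad] at e2
    constructor <;> linarith
  constructor
  · by_contra hD
    have := trace_re_conjTranspose_mul_mul_pos hR.inv hD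
    have h2 := (h1 D).1
    rw [linScore, trace_mul_comm, ← Matrix.mul_assoc] at h2
    linarith
  · set P := R⁻¹ * H * R⁻¹ with hP
    have hPH : P.IsHermitian := isHermitian_inv_mul_mul_inv hR.isHermitian hH
    have h2 (W E : Matrix (Fin N) (Fin K) ℂ) : (Matrix.trace (P * E * Wᴴ)).re = 0 := by
      have e := trace_quadratic_expand hPH W E 1
      have a1 := (h1 (W + (1 : ℝ) • E)).2
      have a2 := (h1 W).2
      have a3 := (h1 E).2
      simp only [quadScore] at a1 a2 a3
      rw [a1, a2, a3] at e
      linarith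
    have h3 (E : Matrix (Fin N) (Fin K) ℂ) : P * E = 0 := by
      have e := h2 (P * E) E
      by_contra hne
      have := trace_re_conjTranspose_mul_mul_pos (PosDef.one (n := Fin N) (R := ℂ)) hne
      rw [Matrix.mul_one, trace_mul_comm] at this
      linarith
    have h4 : P = 0 := by
      -- A right-invertible `N × K` matrix is needed in order to cancel it from `P E = 0`; it exists
      -- because `N ≤ K`.
      calc P = P * rightC N K * (rightC N K)ᴴ := by
            rw [Matrix.mul_assoc, rightC_gram hK, Matrix.mul_one]
        _ = 0 := by rw [h3, Matrix.zero_mul]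
    have hd := PosDef.isUnit_det hR
    calc H = R * P * R := by
          rw [hP, Matrix.mul_assoc, nonsing_inv_mul_cancel_right _ _ hd,
            mul_nonsing_inv_cancel_left _ _ hd]
      _ = 0 := by rw [h4, Matrix.mul_zero, Matrix.zero_mul]

/-- Identifiability: `A` has orthonormal columns and `C` orthonormal rows, so the mean determines
`B_s`. -/
theorem eq_zero_of_meanDir_eq_zero (hJ : t + r ≤ N) (hM : M ≤ K)
    {v : VecIdx r M ⊕ NuisIdx t M N → ℝ} (hD : meanDir K v = 0) (hH : thetaR v = 0) : v = 0 := by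
  have h1 : thetaBs v = 0 := by
    calc thetaBs v = ((leftA N t r)ᴴ * leftA N t r) * thetaBs v *
          (rightC M K * (rightC M K)ᴴ) := by
          rw [leftA_gram hJ, rightC_gram hM, Matrix.one_mul, Matrix.mul_one]
      _ = (leftA N t r)ᴴ * meanDir K v * (rightC M K)ᴴ := by
          simp only [meanDir, Matrix.mul_assoc]
      _ = 0 := by rw [hD, Matrix.mul_zero, Matrix.zero_mul]
  have hB : matOf (fun k => v (Sum.inl k)) = matOf (0 : VecIdx r M → ℝ) := by
    ext i j
    have := congrFun (congrFun h1 (Sum.inr i)) j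
    simpa [thetaBs, matOf, Complex.ext_iff] using this
  have hBt : nuisB (fun k => v (Sum.inr k)) = nuisB (0 : NuisIdx t M N → ℝ) := by
    ext i j
    have := congrFun (congrFun h1 (Sum.inl i)) j
    simpa [thetaBs, nuisB, matOf, Complex.ext_iff] using this
  have hR : nuisR (fun k => v (Sum.inr k)) = nuisR (0 : NuisIdx t M N → ℝ) := by
    refine Eq.trans hH ?_
    ext i j
    simp [nuisR, covOf, Complex.ext_iff]
  have e1 := matOf_injective hB
  have e2 := nuis_ext hBt hR
  ext (k | k)
  · exact congrFun e1 k
  · exact congrFun e2 k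

/-- For `v` in the kernel, `v · I v` is the second moment of the score along `v`. It vanishes, so
that score is identically zero, and `fullScore_eq_zero` with identifiability gives `v = 0`. -/
theorem isUnit_det_fisher (hJ : t + r ≤ N) (hK : M + N ≤ K)
    {θ : VecIdx r M ⊕ NuisIdx t M N → ℝ} (hR : (thetaR θ).PosDef) :
    IsUnit (fisher K θ).det := by
  rw [isUnit_iff_ne_zero]
  intro h0
  obtain ⟨v, hv, hFv⟩ := Matrix.exists_mulVec_eq_zero_iff.2 h0
  apply hv
  set S : (Fin N → Fin K → ℂ) → ℝ := fun Z =>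
    fullScore (thetaR θ) (meanDir K v) (thetaR v) (Matrix.of Z - meanDir K θ) with hS
  have hST : S.HasTemperateGrowth := temperate_fullScore _ _ _ _
  have h1 : ∫ Z, S Z * S Z ∂(gaussLaw (meanDir K θ) (thetaR θ)) = 0 := by
    have e1 (Z : Fin N → Fin K → ℂ) : S Z * S Z = ∑ k, v k * (score (Matrix.of Z) θ k * S Z) := by
      simp only [← mul_assoc, ← Finset.sum_mul]
      rw [sum_mul_score _ hR]
    simp only [e1]
    rw [integral_finsetSum]
    · refine Finset.sum_eq_zero fun k _ => ?_
      rw [integral_const_mul, ← fisher_mulVec_eq_integral hR v k, hFv]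
      simp
    · intro k _
      exact integrable_of_temperate hR ((Function.HasTemperateGrowth.const (v k)).mul
        ((temperate_score hR k).mul hST))
  have hint := (integrable_gaussLaw_iff hR).1
    (integrable_of_temperate (μ := meanDir K θ) hR (hST.mul hST))
  rw [integral_gaussLaw hR, integral_eq_zero_iff_of_nonneg
    (fun Z => mul_nonneg (mul_self_nonneg _) (gaussDensity_pos _ _ hR).le) hint] at h1
  have := isAddHaarMeasure_volume_data N K
  have hc : Continuous fun Z : Fin N → Fin K → ℂ =>
      S Z * S Z * gaussDensity (Matrix.of Z) (meanDir K θ) (thetaR θ) :=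
    (hST.1.continuous.mul hST.1.continuous).mul (continuous_gaussDensity _ _)
  -- Continuity turns vanishing almost everywhere into vanishing at every data point.
  have h2 := (hc.ae_eq_iff_eq volume continuous_const).1 h1
  have h3 (Z : Fin N → Fin K → ℂ) : S Z = 0 := by
    have : S Z * S Z * gaussDensity (Matrix.of Z) (meanDir K θ) (thetaR θ) = 0 := congrFun h2 Z
    have hg := (gaussDensity_pos (Matrix.of Z) (meanDir K θ) hR).ne'
    simpa [hg] using this
  have h4 : ∀ W, fullScore (thetaR θ) (meanDir K v) (thetaR v) W = 0 := fun W => by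
    have := h3 (fun i k => (W + meanDir K θ) i k)
    simp only [hS] at this
    convert this using 1
    congr 1
    change W = (W + meanDir K θ) - meanDir K θ
    abel
  obtain ⟨hD, hH⟩ := fullScore_eq_zero (by omega) hR (thetaR_isHermitian v) h4
  exact eq_zero_of_meanDir_eq_zero hJ (by omega) hD hH

/-- Along a mean `A B C`, the score sees the residual only through `A† R⁻¹ W C†`. Two residuals that
agree there have the same score. -/
theorem linScore_signal {l : Type*} [Fintype l] {R : Matrix (Fin N) (Fin N) ℂ}
    (hR : R.IsHermitian) (A : Matrix (Fin N) l ℂ) (B : Matrix l (Fin M) ℂ)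
    (W : Matrix (Fin N) (Fin K) ℂ) :
    linScore R (A * B * rightC M K) W =
      2 * (Matrix.trace ((Aᴴ * R⁻¹ * sigCols M W)ᴴ * B)).re := by
  rw [linScore, sigCols]
  simp only [conjTranspose_mul, conjTranspose_conjTranspose, hR.inv.eq]
  have : (R⁻¹ * (A * B * rightC M K) * Wᴴ).trace =
      ((R⁻¹ * A * B) * (rightC M K * Wᴴ)).trace := by
    simp only [Matrix.mul_assoc]
  rw [this, trace_mul_comm]
  simp only [Matrix.mul_assoc]

theorem sigCols_signal (hM : M ≤ K) (D : Matrix (Fin N) (Fin M) ℂ) :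
    sigCols M (D * rightC M K) = D := by
  rw [sigCols, Matrix.mul_assoc, rightC_gram hM, Matrix.mul_one]

theorem thetaBs_inl (x : VecIdx r M → ℝ) :
    thetaBs (Sum.elim x (0 : NuisIdx t M N → ℝ)) = Matrix.fromRows 0 (matOf x) := by
  ext (i | i) j <;> simp [thetaBs, nuisB, matOf, Complex.ext_iff]

theorem thetaR_of_inr_inr {v : VecIdx r M ⊕ NuisIdx t M N → ℝ}
    (h : ∀ k, v (Sum.inr (Sum.inr k)) = 0) : thetaR v = 0 := by
  ext i j
  simp [thetaR, nuisR, covOf, h, Complex.ext_iff]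

theorem single_inl (k : VecIdx r M) :
    (Pi.single (Sum.inl k) 1 : VecIdx r M ⊕ NuisIdx t M N → ℝ) =
      Sum.elim (Pi.single k 1) 0 := by
  ext (j | j) <;> simp [Pi.single_apply]

theorem meanDir_inl (x : VecIdx r M → ℝ) :
    meanDir K (Sum.elim x (0 : NuisIdx t M N → ℝ)) = Er N t r * matOf x * rightC M K := by
  rw [meanDir, thetaBs_inl, leftA_mul_fromRows, Matrix.mul_zero, zero_add]

theorem thetaBs_single_inr_inl (k : VecIdx t M) :
    thetaBs (Pi.single (Sum.inr (Sum.inl k)) 1 : VecIdx r M ⊕ NuisIdx t M N → ℝ) =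
      Matrix.fromRows (matOf (Pi.single k 1)) 0 := by
  ext (i | i) j <;> simp [thetaBs, nuisB, matOf, Complex.ext_iff, Pi.single_apply]

theorem meanDir_single_inr_inl (k : VecIdx t M) :
    meanDir K (Pi.single (Sum.inr (Sum.inl k)) 1 : VecIdx r M ⊕ NuisIdx t M N → ℝ) =
      Et N t * matOf (Pi.single k 1) * rightC M K := by
  rw [meanDir, thetaBs_single_inr_inl, leftA_mul_fromRows, Matrix.mul_zero, add_zero]

theorem meanDir_single_inr_inr (k : Fin N × Fin N) :
    meanDir K (Pi.single (Sum.inr (Sum.inr k)) 1 : VecIdx r M ⊕ NuisIdx t M N → ℝ) = 0 := by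
  have : thetaBs (Pi.single (Sum.inr (Sum.inr k)) 1 : VecIdx r M ⊕ NuisIdx t M N → ℝ) = 0 := by
    ext (i | i) j <;> simp [thetaBs, nuisB, matOf, Complex.ext_iff]
  rw [meanDir, this, Matrix.mul_zero, Matrix.zero_mul]

theorem fisher_transpose (θ : VecIdx r M ⊕ NuisIdx t M N → ℝ) :
    (fisher K θ)ᵀ = fisher K θ := by
  ext k l
  simp only [fisher, transpose_apply, of_apply, mul_comm]

/-! ### Scores and statistics at the null estimate -/

section Null

variable {Z : Matrix (Fin N) (Fin K) ℂ}

theorem thetaR_theta0 (ht : t ≤ N) (hK : M + N ≤ K) (hS : (Sc M Z).PosDef) :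
    thetaR (theta0 t r M Z) = R0hat t M Z := nuisR_thetaS0 ht hK hS

theorem meanDir_theta0 (ht : t ≤ N) (hK : M + N ≤ K) (hS : (Sc M Z).PosDef) :
    meanDir K (theta0 t r M Z) = Et N t * nullB t M Z * rightC M K := by
  have h : thetaBs (theta0 t r M Z) = Matrix.fromRows (nullB t M Z) 0 := by
    rw [← nuisB_thetaS0 ht hK hS]
    ext (i | i) j <;> simp [thetaBs, theta0, matOf, Complex.ext_iff]
  rw [meanDir, h, leftA_mul_fromRows, Matrix.mul_zero, add_zero]

theorem sigCols_sub_meanDir_theta0 (ht : t ≤ N) (hK : M + N ≤ K) (hS : (Sc M Z).PosDef) :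
    sigCols M (Z - meanDir K (theta0 t r M Z)) = nullResid t M Z := by
  rw [meanDir_theta0 ht hK hS, ← sigCols_sub_nullB, sigCols, Matrix.sub_mul]
  congr 1
  exact sigCols_signal (by omega) _

theorem score_theta0_inl (ht : t ≤ N) (hK : M + N ≤ K) (hS : (Sc M Z).PosDef)
    (k : VecIdx r M) : score Z (theta0 t r M Z) (Sum.inl k) = linScore (R0hat t M Z)
      (Er N t r * matOf (Pi.single k 1) * rightC M K) (Z - meanDir K (theta0 t r M Z)) := by
  have hR := thetaR_theta0 (r := r) ht hK hS
  rw [score_eq _ (by rw [hR]; exact R0hat_posDef hK hS), hR, single_inl, meanDir_inl,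
    thetaR_of_inr_inr (by simp)]
  simp [fullScore, quadScore]

theorem score_theta0_inr_inl (ht : t ≤ N) (hK : M + N ≤ K) (hS : (Sc M Z).PosDef)
    (k : VecIdx t M) : score Z (theta0 t r M Z) (Sum.inr (Sum.inl k)) = 0 := by
  have hR := thetaR_theta0 (r := r) ht hK hS
  have hRp := R0hat_posDef (t := t) hK hS
  rw [score_eq _ (by rw [hR]; exact hRp), hR, meanDir_single_inr_inl,
    thetaR_of_inr_inr (by simp), fullScore, linScore_signal hRp.isHermitian,
    sigCols_sub_meanDir_theta0 ht hK hS, Et_R0hat_inv_nullResid ht hK hS]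
  simp [quadScore]

/-- The likelihood equation of the signal in terms of the information matrix. -/
theorem fisherRR_mulVec_thetaR01 (hJ : t + r ≤ N) (hK : M + N ≤ K) (hS : (Sc M Z).PosDef) :
    fisherRR K (theta0 t r M Z) *ᵥ thetaR01 t r M Z =
      fun k => score Z (theta0 t r M Z) (Sum.inl k) := by
  have ht : t ≤ N := by omega
  have hR := thetaR_theta0 (r := r) ht hK hS
  have hRp := R0hat_posDef (t := t) hK hS
  ext k
  -- Padding with zeros turns the block into the whole information matrix, to which
  -- `fisher_mulVec_meanDir` applies.
  have h1 : (fisherRR K (theta0 t r M Z) *ᵥ thetaR01 t r M Z) k =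
      (fisher K (theta0 t r M Z) *ᵥ Sum.elim (thetaR01 t r M Z) 0) (Sum.inl k) := by
    simp [fisherRR, Matrix.mulVec, dotProduct, toBlocks₁₁, Fintype.sum_sum_type]
  rw [h1, fisher_mulVec_meanDir (by rw [hR]; exact hRp) (thetaR_of_inr_inr (by simp)),
    score_theta0_inl ht hK hS, hR, single_inl, meanDir_inl, meanDir_inl,
    linScore_signal hRp.isHermitian, linScore_signal hRp.isHermitian,
    sigCols_sub_meanDir_theta0 ht hK hS, sigCols_signal (by omega), thetaR01_eq hJ hK hS,
    matOf_matEnc, restrictedB]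
  simp only [← Matrix.mul_assoc]
  rw [gram_mul_glsCoef hRp (Er_gram hJ)]

/-- By symmetry of `I_rr`, the Durbin form is `(I_rr δ)ᵀ [I⁻¹]_rr (I_rr δ)`, and `I_rr δ` is the
signal score. -/
theorem durbin_eq_rao (hJ : t + r ≤ N) (hK : M + N ≤ K) (hS : (Sc M Z).PosDef) :
    durbin t r M Z = rao t r M Z := by
  have hF := fisherRR_mulVec_thetaR01 hJ hK hS
  have hT : (fisherRR K (theta0 t r M Z))ᵀ = fisherRR K (theta0 t r M Z) := by
    ext i j
    exact congrFun (congrFun (fisher_transpose (K := K) (theta0 t r M Z)) (Sum.inl i)) (Sum.inl j)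
  simp only [durbin, rao, sub_zero]
  rw [← mulVec_mulVec, ← mulVec_mulVec, hF, dotProduct_mulVec, ← mulVec_transpose, hT, hF]

/-- Full parameter direction of the estimate of the whole signal from the null residual. -/
noncomputable def raoDir (t r M : ℕ) (Z : Matrix (Fin N) (Fin K) ℂ) :
    VecIdx r M ⊕ NuisIdx t M N → ℝ :=
  let B := glsCoef (R0hat t M Z) (leftA N t r) * nullResid t M Z
  Sum.elim (matEnc B.toRows₂) (Sum.elim (matEnc B.toRows₁) 0)

theorem thetaBs_raoDir : thetaBs (raoDir t r M Z) =
    glsCoef (R0hat t M Z) (leftA N t r) * nullResid t M Z := by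
  set B := glsCoef (R0hat t M Z) (leftA N t r) * nullResid t M Z with hB
  have h : thetaBs (raoDir t r M Z) =
      Matrix.fromRows (matOf (matEnc B.toRows₁)) (matOf (matEnc B.toRows₂)) := rfl
  rw [h, matOf_matEnc, matOf_matEnc, fromRows_toRows]

theorem thetaR_raoDir : thetaR (raoDir t r M Z) = 0 :=
  thetaR_of_inr_inr fun _ => rfl

/-- The normal equations say that the fit by `A` and the residual itself have the same pairing with
every mean direction. So `I v` is the mean part of the score, whose interference entries vanish. Its
covariance entries vanish because those parameters do not move the mean. -/
theorem fisher_mulVec_raoDir (hJ : t + r ≤ N) (hK : M + N ≤ K) (hS : (Sc M Z).PosDef) :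
    fisher K (theta0 t r M Z) *ᵥ raoDir t r M Z =
      Sum.elim (fun k => score Z (theta0 t r M Z) (Sum.inl k)) 0 := by
  have ht : t ≤ N := by omega
  have hR := thetaR_theta0 (r := r) ht hK hS
  have hRp := R0hat_posDef (t := t) hK hS
  have hRp' : (thetaR (theta0 t r M Z)).PosDef := by rw [hR]; exact hRp
  have key (k) : (fisher K (theta0 t r M Z) *ᵥ raoDir t r M Z) k =
      linScore (R0hat t M Z) (meanDir K (Pi.single k 1)) (Z - meanDir K (theta0 t r M Z)) := by
    rw [fisher_mulVec_meanDir hRp' thetaR_raoDir, hR]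
    conv_lhs => rw [meanDir]
    conv_rhs => rw [meanDir]
    rw [linScore_signal hRp.isHermitian, linScore_signal hRp.isHermitian,
      sigCols_sub_meanDir_theta0 ht hK hS, meanDir, sigCols_signal (by omega), thetaBs_raoDir,
      ← Matrix.mul_assoc, ← Matrix.mul_assoc, gram_mul_glsCoef hRp (leftA_gram hJ)]
  ext (k | k | k)
  · rw [key, Sum.elim_inl, score_theta0_inl ht hK hS, single_inl, meanDir_inl]
  · rw [key, meanDir_single_inr_inl, linScore_signal hRp.isHermitian,
      sigCols_sub_meanDir_theta0 ht hK hS, Et_R0hat_inv_nullResid ht hK hS]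
    simp
  · rw [key, meanDir_single_inr_inr]
    simp [linScore]

theorem rao_eq (hJ : t + r ≤ N) (hK : M + N ≤ K) (hS : (Sc M Z).PosDef) :
    rao t r M Z = 2 * (raoTrace t r M Z).re := by
  have ht : t ≤ N := by omega
  have hR := thetaR_theta0 (r := r) ht hK hS
  have hRp := R0hat_posDef (t := t) hK hS
  have hRp' : (thetaR (theta0 t r M Z)).PosDef := by rw [hR]; exact hRp
  have hF := fisher_mulVec_raoDir hJ hK hS
  set g : VecIdx r M → ℝ := fun k => score Z (theta0 t r M Z) (Sum.inl k) with hg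
  have hI : (fisher K (theta0 t r M Z))⁻¹ *ᵥ Sum.elim g 0 = raoDir t r M Z := by
    rw [← hF, mulVec_mulVec, nonsing_inv_mul _ (isUnit_det_fisher hJ hK hRp'), one_mulVec]
  have hI' : fisherInvRR K (theta0 t r M Z) *ᵥ g = fun k => raoDir t r M Z (Sum.inl k) := by
    rw [← hI]
    ext k
    simp [fisherInvRR, Matrix.mulVec, dotProduct, toBlocks₁₁, Fintype.sum_sum_type]
  have h1 : rao t r M Z = ∑ k, raoDir t r M Z k * score Z (theta0 t r M Z) k := by
    -- The sum extends to all coordinates at no cost: on the interference the score is zero, on the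
    -- covariance `raoDir` is zero. The covariance score is therefore never needed.
    have hz : ∑ k : NuisIdx t M N, raoDir t r M Z (Sum.inr k) *
        score Z (theta0 t r M Z) (Sum.inr k) = 0 := by
      refine Finset.sum_eq_zero ?_
      rintro (k | k) -
      · rw [score_theta0_inr_inl ht hK hS, mul_zero]
      · exact zero_mul _
    rw [Fintype.sum_sum_type, hz, add_zero]
    change g ⬝ᵥ (fisherInvRR K (theta0 t r M Z) *ᵥ g) = _
    rw [hI']
    simp only [dotProduct, hg, mul_comm]
  rw [h1, sum_mul_score _ hRp', thetaR_raoDir, hR, raoTrace_eq hJ hK hS]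
  have h2 : fullScore (R0hat t M Z) (meanDir K (raoDir t r M Z)) 0
      (Z - meanDir K (theta0 t r M Z)) = linScore (R0hat t M Z) (meanDir K (raoDir t r M Z))
      (Z - meanDir K (theta0 t r M Z)) := by simp [fullScore, quadScore]
  rw [h2]
  conv_lhs => rw [meanDir]
  rw [linScore_signal hRp.isHermitian, sigCols_sub_meanDir_theta0 ht hK hS, thetaBs_raoDir,
    glsEnergy]
  simp only [conjTranspose_mul, conjTranspose_conjTranspose, hRp.inv.isHermitian.eq,
    ← Matrix.mul_assoc]

theorem durbin_eq_raoTrace (hJ : t + r ≤ N) (hK : M + N ≤ K) (hS : (Sc M Z).PosDef) :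
    (durbin t r M Z : ℂ) = 2 * raoTrace t r M Z := by
  have h := glsEnergy_eq_ofReal (R0hat_posDef (t := t) hK hS) (leftA_gram hJ) (nullResid t M Z)
  rw [durbin_eq_rao hJ hK hS, rao_eq hJ hK hS, raoTrace_eq hJ hK hS]
  conv_rhs => rw [h]
  push_cast
  rfl

end Null

/-! ### Nondegeneracy of the scatter matrix -/

theorem rightC_eq (M K : ℕ) : rightC M K = (Et K M)ᴴ := by
  ext i j
  simp only [rightC, Et, of_apply, conjTranspose_apply, eq_comm]
  split_ifs <;> simp

theorem one_sub_gram_posSemidef {l e : Type*} [Fintype l] [DecidableEq l] [Fintype e]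
    [DecidableEq e] {A : Matrix l e ℂ} (hA : Aᴴ * A = 1) : (1 - A * Aᴴ).PosSemidef := by
  have h : 1 - A * Aᴴ = (1 - A * Aᴴ)ᴴ * (1 - A * Aᴴ) := by
    have h1 : A * Aᴴ * (A * Aᴴ) = A * Aᴴ := by
      rw [Matrix.mul_assoc, ← Matrix.mul_assoc Aᴴ, hA, Matrix.one_mul]
    simp [Matrix.mul_sub, Matrix.sub_mul, h1]
  rw [h]
  exact posSemidef_conjTranspose_mul_self _

theorem Sc_posSemidef (hM : M ≤ K) (Z : Matrix (Fin N) (Fin K) ℂ) : (Sc M Z).PosSemidef := by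
  have h := one_sub_gram_posSemidef (A := Et K M) (Et_gram hM)
  rw [Sc, proj_rightC hM, rightC_eq, conjTranspose_conjTranspose]
  exact h.mul_mul_conjTranspose_same Z

/-- `Er K M N` selects the `N` columns that follow the `M` signal columns. `S_c` is the Gram matrix
of that square block plus a positive semidefinite contribution of the remaining columns. -/
theorem Sc_posDef_of_det_ne_zero (hK : M + N ≤ K) {Z : Matrix (Fin N) (Fin K) ℂ}
    (hZ : (Z * Er K M N).det ≠ 0) : (Sc M Z).PosDef := by
  have h := one_sub_gram_posSemidef (A := leftA K M N) (leftA_gram hK)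
  have h1 : leftA K M N * (leftA K M N)ᴴ =
      Et K M * (Et K M)ᴴ + Er K M N * (Er K M N)ᴴ := by
    rw [leftA, conjTranspose_fromCols_eq_fromRows_conjTranspose, fromCols_mul_fromRows]
  have h2 : Sc M Z = Z * (1 - leftA K M N * (leftA K M N)ᴴ) * Zᴴ +
      (Z * Er K M N) * (Z * Er K M N)ᴴ := by
    rw [Sc, proj_rightC (by omega), rightC_eq, conjTranspose_conjTranspose, h1, conjTranspose_mul]
    simp only [Matrix.mul_sub, Matrix.mul_add, Matrix.sub_mul, Matrix.add_mul, Matrix.mul_assoc]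
    abel
  rw [h2]
  refine PosDef.posSemidef_add (h.mul_mul_conjTranspose_same Z) ?_
  exact PosDef.mul_conjTranspose_self _ (Matrix.vecMul_injective_iff_isUnit.2
    ((Matrix.isUnit_iff_isUnit_det _).2 (isUnit_iff_ne_zero.2 hZ)))

theorem continuous_of_data : Continuous fun Z : Fin N → Fin K → ℂ =>
    (Matrix.of Z : Matrix (Fin N) (Fin K) ℂ) := continuous_id

theorem measurableSet_Sc_posDef (hM : M ≤ K) :
    MeasurableSet {Z : Fin N → Fin K → ℂ | (Sc M (Matrix.of Z)).PosDef} := by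
  simp only [(Sc_posSemidef hM _).posDef_iff_det_ne_zero]
  have hc : Continuous fun Z : Fin N → Fin K → ℂ => (Sc M (Matrix.of Z)).det :=
    ((continuous_of_data.matrix_mul continuous_const).matrix_mul
      continuous_of_data.matrix_conjTranspose).matrix_det
  exact (isOpen_ne_fun hc continuous_const).measurableSet

/-- By a Fubini argument it suffices to treat the lines `Y + s Z₀` in one fixed direction. -/
theorem ae_Sc_posDef (hK : M + N ≤ K) :
    ∀ᵐ Z : Fin N → Fin K → ℂ, (Sc M (Matrix.of Z)).PosDef := by
  have := isAddHaarMeasure_volume_data N K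
  -- Along this direction the square block becomes `V + s I`. Its determinant is the characteristic
  -- polynomial of `-V` at `s`, which has finitely many zeros.
  let Z₀ : Fin N → Fin K → ℂ := fun i k => (Er K M N)ᴴ i k
  refine ae_mem_of_ae_add_linearMap_mem (LinearMap.toSpanSingleton ℝ (Fin N → Fin K → ℂ) Z₀)
    volume volume (measurableSet_Sc_posDef (by omega)) fun Y => ?_
  set V : Matrix (Fin N) (Fin N) ℂ := Matrix.of Y * Er K M N with hV
  have hfin : {s : ℝ | ((-V).charpoly).eval (s : ℂ) = 0}.Finite := by
    have h1 : {z : ℂ | ((-V).charpoly).eval z = 0}.Finite := by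
      refine ((-V).charpoly.roots.toFinset.finite_toSet).subset fun z hz => ?_
      simpa [Polynomial.mem_roots (Matrix.charpoly_monic (-V)).ne_zero] using hz
    exact h1.preimage Complex.ofReal_injective.injOn
  have hae : ∀ᵐ s : ℝ, s ∉ {s : ℝ | ((-V).charpoly).eval (s : ℂ) = 0} :=
    measure_eq_zero_iff_ae_notMem.1 (hfin.measure_zero volume)
  filter_upwards [hae] with s hs
  refine Sc_posDef_of_det_ne_zero hK ?_
  have h2 : (Matrix.of (Y + LinearMap.toSpanSingleton ℝ (Fin N → Fin K → ℂ) Z₀ s) :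
      Matrix (Fin N) (Fin K) ℂ) * Er K M N = Matrix.scalar (Fin N) (s : ℂ) - (-V) := by
    have h3 : (Matrix.of (Y + LinearMap.toSpanSingleton ℝ (Fin N → Fin K → ℂ) Z₀ s) :
      Matrix (Fin N) (Fin K) ℂ) = Matrix.of Y + (s : ℂ) • (Er K M N)ᴴ := by
      ext i k; simp [Z₀]
    rw [h3, Matrix.add_mul, Matrix.smul_mul, Er_gram hK, sub_neg_eq_add, hV, add_comm]
    congr 1
    ext i j
    simp [Matrix.scalar_apply, Matrix.diagonal_apply, Matrix.one_apply]
  rw [h2, ← Matrix.eval_charpoly]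
  exact hs

/-! ### Measurability -/

section Measurability

variable {α l m n : Type*} [MeasurableSpace α]

/-- Matrix-valued functions with measurable entries. -/
def MatMeasurable (F : α → Matrix l m ℂ) : Prop := ∀ i j, Measurable fun x => F x i j

theorem MatMeasurable.const (A : Matrix l m ℂ) : MatMeasurable fun _ : α => A :=
  fun _ _ => measurable_const

theorem MatMeasurable.add {F G : α → Matrix l m ℂ} (hF : MatMeasurable F) (hG : MatMeasurable G) :
    MatMeasurable fun x => F x + G x := fun i j => (hF i j).add (hG i j)

theorem MatMeasurable.sub {F G : α → Matrix l m ℂ} (hF : MatMeasurable F) (hG : MatMeasurable G) :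
    MatMeasurable fun x => F x - G x := fun i j => (hF i j).sub (hG i j)

theorem MatMeasurable.const_smul {F : α → Matrix l m ℂ} (c : ℂ) (hF : MatMeasurable F) :
    MatMeasurable fun x => c • F x := fun i j => (hF i j).const_mul c

theorem MatMeasurable.conjTranspose {F : α → Matrix l m ℂ} (hF : MatMeasurable F) :
    MatMeasurable fun x => (F x)ᴴ := fun i j => Complex.continuous_conj.measurable.comp (hF j i)

theorem MatMeasurable.mul [Fintype m] {F : α → Matrix l m ℂ} {G : α → Matrix m n ℂ}
    (hF : MatMeasurable F) (hG : MatMeasurable G) : MatMeasurable fun x => F x * G x := fun i j => by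
  simp only [Matrix.mul_apply]
  exact Finset.measurable_fun_sum _ fun k _ => (hF i k).mul (hG k j)

theorem MatMeasurable.det [Fintype l] [DecidableEq l] {F : α → Matrix l l ℂ}
    (hF : MatMeasurable F) : Measurable fun x => (F x).det := by
  simp only [Matrix.det_apply]
  exact Finset.measurable_fun_sum _ fun σ _ =>
    (Finset.measurable_fun_prod _ fun i _ => hF (σ i) i).const_smul _

theorem MatMeasurable.inv [Fintype l] [DecidableEq l] {F : α → Matrix l l ℂ}
    (hF : MatMeasurable F) : MatMeasurable fun x => (F x)⁻¹ := fun i j => by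
  simp only [Matrix.inv_def, Ring.inverse_eq_inv', Matrix.smul_apply, smul_eq_mul,
    Matrix.adjugate_apply]
  refine hF.det.inv.mul (MatMeasurable.det fun k m => ?_)
  by_cases h : k = j
  · subst h; simp
  · simpa [Matrix.updateRow_ne h] using hF k m

theorem MatMeasurable.trace [Fintype l] {F : α → Matrix l l ℂ} (hF : MatMeasurable F) :
    Measurable fun x => (F x).trace := by
  simp only [Matrix.trace, Matrix.diag]
  exact Finset.measurable_fun_sum _ fun k _ => hF k k

theorem MatMeasurable.glsCoef [Fintype l] [DecidableEq l] [Fintype m] [DecidableEq m]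
    {S : α → Matrix l l ℂ} (hS : MatMeasurable S) (E : Matrix l m ℂ) :
    MatMeasurable fun x => glsCoef (S x) E :=
  (((MatMeasurable.const Eᴴ).mul hS.inv).mul (.const E)).inv.mul
    ((MatMeasurable.const Eᴴ).mul hS.inv)

end Measurability

/-- The trace form of the statistic as an everywhere defined rational expression. -/
noncomputable def closedStat (t r M : ℕ) (Z : Matrix (Fin N) (Fin K) ℂ) : ℝ :=
  2 * (glsEnergy ((K : ℂ)⁻¹ • (Sc M Z + nullResid t M Z * (nullResid t M Z)ᴴ)) (leftA N t r)
    (nullResid t M Z)).re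

/-- The Durbin statistic contains choices of maximizers, whose measurability is unclear. It becomes
measurable up to a null set through this equality. -/
theorem durbin_eq_closedStat (hJ : t + r ≤ N) (hK : M + N ≤ K) {Z : Matrix (Fin N) (Fin K) ℂ}
    (hS : (Sc M Z).PosDef) : durbin t r M Z = closedStat t r M Z := by
  rw [durbin_eq_rao hJ hK hS, rao_eq hJ hK hS, raoTrace_eq hJ hK hS, R0hat_eq (by omega) hS,
    closedStat]

theorem measurable_closedStat :
    Measurable fun Z : Fin N → Fin K → ℂ => closedStat t r M (Matrix.of Z) := by
  have hZ : MatMeasurable fun Z : Fin N → Fin K → ℂ => (Matrix.of Z : Matrix _ _ ℂ) :=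
    fun i k => (measurable_pi_apply k).comp (measurable_pi_apply i)
  have hS : MatMeasurable fun Z : Fin N → Fin K → ℂ => Sc M (Matrix.of Z) :=
    (hZ.mul (.const _)).mul hZ.conjTranspose
  have hY : MatMeasurable fun Z : Fin N → Fin K → ℂ => sigCols M (Matrix.of Z) :=
    hZ.mul (.const _)
  have hX : MatMeasurable fun Z : Fin N → Fin K → ℂ => nullResid t M (Matrix.of Z) :=
    hY.sub ((MatMeasurable.const _).mul ((hS.glsCoef (Et N t)).mul hY))
  have hR : MatMeasurable fun Z : Fin N → Fin K → ℂ => (K : ℂ)⁻¹ • (Sc M (Matrix.of Z) +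
      nullResid t M (Matrix.of Z) * (nullResid t M (Matrix.of Z))ᴴ) :=
    (hS.add (hX.mul hX.conjTranspose)).const_smul _
  have h : MatMeasurable fun Z : Fin N → Fin K → ℂ => _ :=
    ((hX.conjTranspose.mul hR.inv).mul (.const (leftA N t r))).mul
      ((hR.glsCoef (leftA N t r)).mul hX)
  exact (Complex.measurable_re.comp h.trace).const_mul 2

/-! ### Invariance -/

theorem isUnit_det_of_intertwine {l e : Type*} [Fintype l] [DecidableEq l] [Fintype e]
    [DecidableEq e] {T : Matrix l l ℂ} {E : Matrix l e ℂ} {u : Matrix e e ℂ} (hT : IsUnit T.det)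
    (hE : Eᴴ * E = 1) (h : T * E = E * u) : IsUnit u.det := by
  refine Matrix.isUnit_det_of_left_inverse (B := Eᴴ * T⁻¹ * E) ?_
  rw [Matrix.mul_assoc, ← h, Matrix.mul_assoc, nonsing_inv_mul_cancel_left _ _ hT, hE]

theorem Sc_affine (hM : M ≤ K) (T : Matrix (Fin N) (Fin N) ℂ) (D : Matrix (Fin N) (Fin M) ℂ)
    (Z : Matrix (Fin N) (Fin K) ℂ) : Sc M (T * Z + D * rightC M K) = T * Sc M Z * Tᴴ := by
  have h1 : rightC M K * (1 - (rightC M K)ᴴ * rightC M K) = 0 := by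
    rw [Matrix.mul_sub, ← Matrix.mul_assoc, rightC_gram hM, Matrix.mul_one, Matrix.one_mul,
      sub_self]
  have h2 : (1 - (rightC M K)ᴴ * rightC M K) * (rightC M K)ᴴ = 0 := by
    rw [Matrix.sub_mul, Matrix.mul_assoc, rightC_gram hM, Matrix.mul_one, Matrix.one_mul,
      sub_self]
  rw [Sc, Sc, proj_rightC hM]
  set P := 1 - (rightC M K)ᴴ * rightC M K
  have h3 : T * Z * P * ((rightC M K)ᴴ * Dᴴ) = 0 := by
    rw [Matrix.mul_assoc (T * Z), ← Matrix.mul_assoc P, h2, Matrix.zero_mul, Matrix.mul_zero]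
  rw [Matrix.add_mul, Matrix.mul_assoc D, h1, Matrix.mul_zero, add_zero, conjTranspose_add,
    Matrix.mul_add, conjTranspose_mul D, h3, add_zero, conjTranspose_mul]
  simp only [Matrix.mul_assoc]

theorem sigCols_affine (hM : M ≤ K) (T : Matrix (Fin N) (Fin N) ℂ) (D : Matrix (Fin N) (Fin M) ℂ)
    (Z : Matrix (Fin N) (Fin K) ℂ) :
    sigCols M (T * Z + D * rightC M K) = T * sigCols M Z + D := by
  rw [sigCols, Matrix.add_mul, Matrix.mul_assoc D, rightC_gram hM, Matrix.mul_one,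
    Matrix.mul_assoc]
  rfl

/-- Transformations preserving the ranges of `E_t` and `A`, together with shifts of the
interference, turn `S_c` into `T S_c T†` and `X` into `T X`; the energy is invariant under this
change. -/
theorem closedStat_affine (hJ : t + r ≤ N) (hM : M ≤ K) {T : Matrix (Fin N) (Fin N) ℂ}
    (hT : IsUnit T.det) {u : Matrix (Fin t) (Fin t) ℂ} {v : Matrix (Fin t ⊕ Fin r) (Fin t ⊕ Fin r) ℂ}
    (hu : T * Et N t = Et N t * u) (hv : T * leftA N t r = leftA N t r * v)
    (b : Matrix (Fin t) (Fin M) ℂ) {Z : Matrix (Fin N) (Fin K) ℂ} (hS : (Sc M Z).PosDef) :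
    closedStat t r M (T * Z + Et N t * b * rightC M K) = closedStat t r M Z := by
  have ht : t ≤ N := by omega
  have hX : nullResid t M (T * Z + Et N t * b * rightC M K) = T * nullResid t M Z := by
    rw [nullResid, Sc_affine hM, sigCols_affine hM, glsResid_conj hS (Et_gram ht) hT
      (isUnit_det_of_intertwine hT (Et_gram ht) hu) hu]
    rfl
  have hR : (K : ℂ)⁻¹ • (T * Sc M Z * Tᴴ + T * nullResid t M Z * (T * nullResid t M Z)ᴴ) =
      T * ((K : ℂ)⁻¹ • (Sc M Z + nullResid t M Z * (nullResid t M Z)ᴴ)) * Tᴴ := by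
    rw [Matrix.mul_smul, Matrix.smul_mul, conjTranspose_mul]
    simp only [Matrix.mul_add, Matrix.add_mul, Matrix.mul_assoc]
  rw [closedStat, hX, Sc_affine hM, hR,
    glsEnergy_conj hT (isUnit_det_of_intertwine hT (leftA_gram hJ) hv) hv, closedStat]

/-! ### The upper triangular group and the false alarm probability -/

theorem mul_Et_of_upper {T : Matrix (Fin N) (Fin N) ℂ} (hT : ∀ i j, j < i → T i j = 0)
    (ht : t ≤ N) : ∃ u : Matrix (Fin t) (Fin t) ℂ, T * Et N t = Et N t * u := by
  refine ⟨(Et N t)ᴴ * (T * Et N t), ?_⟩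
  ext i j
  have hcol : (T * Et N t) i j = T i (Fin.castLE ht j) := by
    rw [Matrix.mul_apply, Finset.sum_eq_single (Fin.castLE ht j)]
    · simp [Et]
    · intro b _ hb
      have : (b : ℕ) ≠ j := fun h' => hb (Fin.ext h')
      simp [Et, this]
    · simp
  rw [Matrix.mul_apply (M := Et N t)]
  by_cases hi : (i : ℕ) < t
  · rw [Finset.sum_eq_single ⟨i, hi⟩]
    · rw [conjTranspose_mul_Et ht]
      simp [Et]
    · intro b _ hb
      have : (i : ℕ) ≠ b := fun h' => hb (Fin.ext h'.symm)
      simp [Et, this]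
    · simp
  · rw [hcol, hT i _ (by rw [Fin.lt_def]; simp; have := j.2; omega), eq_comm]
    refine Finset.sum_eq_zero fun b _ => ?_
    have : (i : ℕ) ≠ b := by have := b.2; omega
    simp [Et, this]

/-- `A` spans the first `t + r` coordinates, so the argument for `E_t` covers both members of the
flag. -/
theorem leftA_eq_submatrix (N t r : ℕ) :
    leftA N t r = (Et N (t + r)).submatrix id finSumFinEquiv := by
  ext i (j | j) <;> simp [leftA, Et, Er]

theorem mul_leftA_of_upper {T : Matrix (Fin N) (Fin N) ℂ} (hT : ∀ i j, j < i → T i j = 0)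
    (hJ : t + r ≤ N) : ∃ v : Matrix (Fin t ⊕ Fin r) (Fin t ⊕ Fin r) ℂ, T * leftA N t r = leftA N t r * v := by
  obtain ⟨u, hu⟩ := mul_Et_of_upper hT hJ
  refine ⟨u.submatrix finSumFinEquiv finSumFinEquiv, ?_⟩
  rw [leftA_eq_submatrix, Matrix.submatrix_mul_equiv, ← hu]
  rfl

/-- Cholesky factorization with an upper triangular factor. -/
theorem exists_upper_mul_conjTranspose {R : Matrix (Fin N) (Fin N) ℂ} (hR : R.PosDef) :
    ∃ T : Matrix (Fin N) (Fin N) ℂ, IsUnit T.det ∧ R = T * Tᴴ ∧ ∀ i j, j < i → T i j = 0 := by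
  -- The factorization is applied to `R⁻¹`: from `L R⁻¹ L† = D` with `L` lower triangular follows `R
  -- = L† D⁻¹ L`, whose left factor is upper triangular.
  set L := LDL.lowerInv hR.inv with hL
  have hLu : IsUnit L.det := (Matrix.isUnit_iff_isUnit_det _).1 (isUnit_of_invertible L)
  have hLh : IsUnit (Lᴴ).det := by simpa [det_conjTranspose] using hLu
  have hRd := PosDef.isUnit_det hR
  set d := LDL.diagEntries hR.inv with hd
  have hD : diagonal d = L * R⁻¹ * Lᴴ := LDL.diag_eq_lowerInv_conj hR.inv
  have hDp : (diagonal d).PosDef := by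
    rw [hD]
    exact hR.inv.mul_mul_conjTranspose_same
      (Matrix.vecMul_injective_iff_isUnit.2 ((Matrix.isUnit_iff_isUnit_det _).2 hLu))
  have hdp (i : Fin N) : 0 < d i := by simpa using posDef_diagonal_iff.1 hDp i
  -- `δ` is the diagonal of `D^{-1/2}`, so that `T = L† D^{-1/2}`.
  set δ : Fin N → ℂ := fun i => ((Real.sqrt (d i).re)⁻¹ : ℝ) with hδ
  have hdd : diagonal δ * (diagonal δ)ᴴ = (diagonal d)⁻¹ := by
    symm
    refine Matrix.inv_eq_right_inv ?_
    rw [diagonal_conjTranspose, diagonal_mul_diagonal, diagonal_mul_diagonal, ← diagonal_one]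
    congr 1
    ext i
    have h1 := Complex.pos_iff.1 (hdp i)
    have h2 : d i = ((d i).re : ℂ) := Complex.ext rfl (by simp [← h1.2])
    have h3 : (d i).re * ((Real.sqrt (d i).re)⁻¹ * (Real.sqrt (d i).re)⁻¹) = 1 := by
      rw [← mul_inv, Real.mul_self_sqrt h1.1.le, mul_inv_cancel₀ h1.1.ne']
    have h4 : star (δ i) = δ i := by simp [hδ]
    change d i * (δ i * star (δ i)) = 1
    rw [h4, h2]
    simp only [hδ]
    exact_mod_cast h3
  have hRT : R = (Lᴴ * diagonal δ) * (Lᴴ * diagonal δ)ᴴ := by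
    have : (Lᴴ * diagonal δ) * (Lᴴ * diagonal δ)ᴴ =
        Lᴴ * (diagonal δ * (diagonal δ)ᴴ) * L := by
      rw [conjTranspose_mul, conjTranspose_conjTranspose]; simp only [Matrix.mul_assoc]
    rw [this, hdd, hD, Matrix.mul_inv_rev, Matrix.mul_inv_rev, nonsing_inv_nonsing_inv _ hRd,
      mul_nonsing_inv_cancel_left _ _ hLh, nonsing_inv_mul_cancel_right _ _ hLu]
  refine ⟨Lᴴ * diagonal δ, ?_, hRT, fun i j hij => ?_⟩
  · rw [hRT, det_mul] at hRd
    exact isUnit_of_mul_isUnit_left hRd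
  · rw [Matrix.mul_diagonal, conjTranspose_apply, hL, LDL.lowerInv_triangular hR.inv hij, star_zero,
      zero_mul]

/-- With an upper triangular `T`, the null law is the image of the standard law under `Z ↦ T Z + E_t
B C`, and this map leaves the statistic unchanged for almost all data. -/
theorem law0_closedStat (hJ : t + r ≤ N) (hK : M + N ≤ K) (η : ℝ)
    (Bt : Matrix (Fin t) (Fin M) ℂ) {R : Matrix (Fin N) (Fin N) ℂ} (hR : R.PosDef) :
    law0 K Bt R {Z | η < closedStat t r M (Matrix.of Z)} =
      gaussLaw (N := N) (K := K) 0 1 {Z | η < closedStat t r M (Matrix.of Z)} := by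
  obtain ⟨T, hT, rfl, hup⟩ := exists_upper_mul_conjTranspose hR
  obtain ⟨u, hu⟩ := mul_Et_of_upper (t := t) hup (by omega)
  obtain ⟨v, hv⟩ := mul_leftA_of_upper (t := t) (r := r) hup hJ
  have hm : MeasurableSet {Z : Fin N → Fin K → ℂ | η < closedStat t r M (Matrix.of Z)} :=
    measurableSet_lt measurable_const measurable_closedStat
  change gaussLaw (Et N t * Bt * rightC M K) (T * Tᴴ) _ = _
  rw [gaussLaw_eq_map hT, Measure.map_apply (continuous_affineMap _ _).measurable hm]
  refine measure_congr ?_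
  have hae : ∀ᵐ Z ∂(gaussLaw (N := N) (K := K) 0 1), (Sc M (Matrix.of Z)).PosDef :=
    (withDensity_absolutelyContinuous _ _).ae_le (ae_Sc_posDef hK)
  filter_upwards [hae] with Z hZ
  have := closedStat_affine hJ (by omega) hT hu hv Bt hZ
  change (η < closedStat t r M (T * Matrix.of Z + Et N t * Bt * rightC M K)) =
    (η < closedStat t r M (Matrix.of Z))
  rw [this]

theorem isCFAR_durbin (hJ : t + r ≤ N) (hK : M + N ≤ K) :
    IsCFAR t M (durbin t r M : Matrix (Fin N) (Fin K) ℂ → ℝ) := by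
  have hae : (fun Z : Fin N → Fin K → ℂ => durbin t r M (Matrix.of Z)) =ᵐ[volume]
      fun Z => closedStat t r M (Matrix.of Z) := by
    filter_upwards [ae_Sc_posDef (M := M) hK] with Z hZ
    exact durbin_eq_closedStat hJ hK hZ
  refine ⟨⟨_, measurable_closedStat, hae⟩, fun η Bt Bt' R R' hR hR' => ?_⟩
  have h (B : Matrix (Fin t) (Fin M) ℂ) {Q : Matrix (Fin N) (Fin N) ℂ} (hQ : Q.PosDef) :
      law0 K B Q {Z | η < durbin t r M (Matrix.of Z)} =
        gaussLaw (N := N) (K := K) 0 1 {Z | η < closedStat t r M (Matrix.of Z)} := by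
    rw [← law0_closedStat hJ hK η B hQ]
    refine measure_congr ?_
    filter_upwards [(withDensity_absolutelyContinuous _ _).ae_le hae] with Z hZ
    change (η < durbin t r M (Matrix.of Z)) = (η < closedStat t r M (Matrix.of Z))
    rw [hZ]
  rw [h Bt hR, h Bt' hR']

end IGmanova

open IGmanova
theorem theorem1 (N K t r M : ℕ) (hJ : t + r ≤ N) (hK : M + N ≤ K) :
    -- the laws are probability measures, and the Fisher information matrix is a genuine,
    -- invertible matrix of expectations of genuine derivatives
    (∀ θ : VecIdx r M ⊕ NuisIdx t M N → ℝ, (thetaR θ).PosDef →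
      IsProbabilityMeasure (law1 K (thetaBs θ) (thetaR θ)) ∧
      (∀ Z : Matrix (Fin N) (Fin K) ℂ, DifferentiableAt ℝ (logLik Z) θ) ∧
      (∀ k l, MeasureTheory.Integrable
        (fun Z : Fin N → Fin K → ℂ => score (Matrix.of Z) θ k * score (Matrix.of Z) θ l)
        (law1 K (thetaBs θ) (thetaR θ))) ∧
      IsUnit (fisher K θ).det) ∧
    -- `S_c` is positive definite for almost all data
    (∀ᵐ Z : Fin N → Fin K → ℂ, (Sc M (Matrix.of Z)).PosDef) ∧
    -- for all such data the estimates exist and are unique, and the statistics agree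
    (∀ Z : Matrix (Fin N) (Fin K) ℂ, (Sc M Z).PosDef →
      (∃! θs : NuisIdx t M N → ℝ, IsNullMLE Z θs) ∧
      nuisR (thetaS0 t M Z) = R0hat t M Z ∧
      (∃! θr : VecIdx r M → ℝ, IsRestrictedMLE Z (thetaS0 t M Z) θr) ∧
      durbin t r M Z = rao t r M Z ∧
      (durbin t r M Z : ℂ) = 2 * raoTrace t r M Z) ∧
    -- statistical equivalence and CFAR
    StatEquivalent (N := N) (K := K) (durbin t r M) (rao t r M) ∧
    StatEquivalent (durbin t r M) (fun Z : Matrix (Fin N) (Fin K) ℂ => (raoTrace t r M Z).re) ∧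
    IsCFAR t M (durbin t r M : Matrix (Fin N) (Fin K) ℂ → ℝ) := by
  refine ⟨fun θ hR => ⟨isProbabilityMeasure_gaussLaw _ hR, fun Z => differentiableAt_logLik Z hR,
    fun k l => integrable_score_mul_score hR k l, isUnit_det_fisher hJ hK hR⟩,
    ae_Sc_posDef hK, fun Z hS => ⟨⟨_, (isNullMLE_iff (by omega) hK hS _).2 rfl,
      fun x hx => (isNullMLE_iff (by omega) hK hS x).1 hx⟩, nuisR_thetaS0 (by omega) hK hS,
      ⟨_, (isRestrictedMLE_iff hJ hK hS _).2 rfl, fun x hx => (isRestrictedMLE_iff hJ hK hS x).1 hx⟩,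
      durbin_eq_rao hJ hK hS, durbin_eq_raoTrace hJ hK hS⟩,
    ⟨id, strictMono_id, ?_⟩, ⟨fun x => 2 * x, fun x y h => by beta_reduce; linarith, ?_⟩,
    isCFAR_durbin hJ hK⟩
  · filter_upwards [ae_Sc_posDef (M := M) hK] with Z hZ
    exact durbin_eq_rao hJ hK hZ
  · filter_upwards [ae_Sc_posDef (M := M) hK] with Z hZ
    rw [durbin_eq_rao hJ hK hZ, rao_eq hJ hK hZ]
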